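/- **Language and theories.** Fix a first-order language $\mathscr L$: a set $\mathscr L_q$ of quantifier symbols and sets $\mathscr L_n$ $(n\in\omega)$ of $n$-ary connectives, with designated $e\in\mathscr L_0$ and $\otimes\in\mathscr L_2$. A (small) signature $Sg$ consists of a set of sorts, a set of function symbols $f:\sigma_1,\dots,\sigma_n\to\tau$ and a set of relation symbols $R:\sigma_1,\dots,\sigma_n$. Terms in context $M:\tau\,[\Gamma]$, $\Gamma=x_1:\sigma_1,\dots,x_n:\sigma_n$, are built from variables and function symbols; formulas in context $\varphi\,[\Gamma]$ are built from $R(M_1,\dots,M_n)$, $M=_\sigma N$, $\Diamond(\varphi_1,\dots,\varphi_n)$ for $\Diamond\in\mathscr L_n$, and $\Omega_{x:\sigma}(\varphi)\,[\Gamma]$ for $\varphi\,[\Gamma,x:\sigma]$, $\Omega\in\mathscr L_q$; contexts and formulas are taken up to renaming of variables. An $Sg$-assertion is an equation $M=N:\tau\,[\Gamma]$ or a sequent $\Phi\vdash\psi\,[\Gamma]$ with $\Phi$ a finite list of formulas; an $Sg$-theory is any set of $Sg$-assertions. An $Sg$-theory is an $\mathcal L^m$-theory if it is closed under typed equational logic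 (equality is reflexive, symmetric, transitive and compatible with substitution, in particular with context weakening) and under the rules * $\varphi\vdash\varphi\,[\Gamma]$; from $\varphi\vdash\psi\,[\Gamma]$ and $\psi\vdash\theta\,[\Gamma]$ infer $\varphi\vdash\theta\,[\Gamma]$; * from $\Phi\vdash\psi\,[\Gamma]$ infer $\Phi\vdash\psi\,[\Gamma,x:\sigma]$; * from $M=M':\sigma\,[\Delta]$ and $\Phi\vdash\psi\,[\Gamma,x:\sigma,\Gamma']$, where the variables of $\Delta$ are among those of $\Gamma,\Gamma'$, infer $\Phi[M/x]\vdash\psi[M'/x]\,[\Gamma,\Gamma']$; * from $\varphi\dashv\vdash\psi\,[\Gamma,x:\sigma]$ infer $\Omega_{x:\sigma}(\varphi)\vdash\Omega_{x:\sigma}(\psi)\,[\Gamma]$; from $\varphi_i\dashv\vdash\varphi_i'\,[\Gamma]$ $(1\le i\le n)$ infer $\Diamond(\varphi_1,\dots,\varphi_n)\vdash\Diamond(\varphi_1',\dots,\varphi_n')\,[\Gamma]$; * $\Phi,\alpha,\beta,\Psi\vdash\theta\,[\Gamma]$ and $\Phi,\alpha\otimes\beta,\Psi\vdash\theta\,[\Gamma]$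 may be inferred from each other, and so may $\Phi,e,\Psi\vdash\theta\,[\Gamma]$ and $\Phi,\Psi\vdash\theta\,[\Gamma]$. **Prop-categories.** A prop-category $(\mathcal C,P)$ is a (locally small) category $\mathcal C$ with designated finite products together with a contravariant functor $P$ from $\mathcal C$ to the category of posets and monotone maps. $\mathrm{Ob}(\mathbf{FA})$ is the class of prop-categories equipped with the following data: (1) each $P(c)$ is an algebra for the connectives and each $P(f)$ is a homomorphism of these algebras; (2) an element $Eq_c\in P(c\times c)$ for each $c$; (3) for each $\Omega\in\mathscr L_q$ maps $\Omega_{b,c}:P(b\times c)\to P(b)$ natural in $b$ (not necessarily monotone); such that (4) $(P(c),\otimes,e)$ is a monoid; (5) $\Omega_{b,1}\circ P(\pi_1^{b,1})=\mathrm{id}$ and $\Omega_{b,c\times d}\circ P(a_{b,c,d})=\Omega_{b,c}\circ\Omega_{b\times c,d}$, where $a_{b,c,d}:b\times(c\times d)\to(b\times c)\times d$ is the canonical isomorphism; (6) $Eq_1=e_{1\times1}$, and for $c=c_1\times c_2$, $Eq_c=P(\langle\pi_1\pi_1^{c,c},\pi_1\pi_2^{c,c}\rangle)Eq_{c_1}\otimes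 P(\langle\pi_2\pi_1^{c,c},\pi_2\pi_2^{c,c}\rangle)Eq_{c_2}$, where $\pi_i=\pi_i^{c_1,c_2}$. A morphism $F:(\mathcal C,P)\to(\mathcal D,Q)$ is a finite product preserving functor $F^o:\mathcal C\to\mathcal D$ with a natural transformation $F^p:P\Rightarrow Q\circ F^o$ by monotone maps that commute with the connectives and, up to the canonical isomorphisms $F^o(b\times c)\cong F^ob\times F^oc$, with the maps $\Omega_{b,c}$ and the elements $Eq_c$. It exhibits $(\mathcal C,P)$ as a subprop-category of $(\mathcal D,Q)$ if $F^o$ is faithful and every $F^p_c$ is an order embedding. Products $\prod_{i\in I}(\mathcal C_i,P_i)$ over small sets $I$ (including $I=\emptyset$) are formed componentwise. **Semantics.** An $Sg$-structure $S$ in $(\mathcal C,P)\in\mathrm{Ob}(\mathbf{FA})$ assigns to each sort an object, to each $f:\sigma_1,\dots,\sigma_n\to\tau$ a morphism $S\sigma_1\times\dots\times S\sigma_n\to S\tau$, and to each $R:\sigma_1,\dots,\sigma_n$ an element of $P(S\sigma_1\times\dots\times S\sigma_n)$. Terms and formulas in context are interpreted as morphisms and as elements of the posets over the interpretations of their contexts: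 variables by projections, substitution into symbols by composition and by $P$, $M=_\sigma N$ by $P(\langle [\![M]\!],[\![N]\!]\rangle)Eq$, connectives by the algebra operations, and quantifiers by the maps $\Omega_{b,c}$. $S$ satisfies $M=N:\tau\,[\Gamma]$ if $[\![M]\!]=[\![N]\!]$, and $\varphi_1,\dots,\varphi_n\vdash\psi\,[\Gamma]$ if $[\![\varphi_1]\!]\otimes\dots\otimes[\![\varphi_n]\!]\le[\![\psi]\!]$ (the left side is $e$ if $n=0$). For $\mathcal X\subseteq\mathrm{Ob}(\mathbf{FA})$ and $Sg$-theories $T,T'$ write $T\vDash^{Sg}_{\mathcal X}T'$ if every $Sg$-structure in a member of $\mathcal X$ that satisfies $T$ satisfies $T'$. Write $\mathrm{Ob}(\mathbf{FA}^{Sg}_{(\cdot)})\circ\vDash^{Sg}_{(\cdot)}(\mathcal X)$, the closure of $\mathcal X$ under $Sg$-consequence, for the class of all $(\mathcal D,Q)\in\mathrm{Ob}(\mathbf{FA})$ for which $\vDash^{Sg}_{\mathcal X}$ is sound: for all $Sg$-theories $T,T'$, $T\vDash^{Sg}_{\mathcal X}T'$ implies $T\vDash^{Sg}_{\{(\mathcal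 D,Q)\}}T'$. **Classifying prop-categories.** For an $\mathcal L^m$-theory $T$ over $Sg$, $(\mathcal C_T,P_T)\in\mathrm{Ob}(\mathbf{FA})$ is the following prop-category. The objects of $\mathcal C_T$ are the contexts; a morphism $\Gamma'\to\Gamma$ is a list of terms in context $\Gamma'$, one for each variable of $\Gamma$, up to equality of the entries provable in $T$; composition is substitution and products are concatenations of contexts. $P_T(\Gamma)$ is the set of formulas in context $\Gamma$ modulo $\varphi\sim\psi$ iff $\varphi\vdash\psi\,[\Gamma]$ and $\psi\vdash\varphi\,[\Gamma]$ are in $T$, ordered by $\varphi\le\psi$ iff $\varphi\vdash\psi\,[\Gamma]\in T$; $P_T$ acts on morphisms by substitution. Connectives and iterated quantifiers $\Omega_{\Gamma,\Gamma'}=\Omega_{y_1}\cdots\Omega_{y_m}$ ($\Gamma'=y_1,\dots,y_m$) act on classes, and $Eq_\Gamma$ is the class of $x_1=x_1'\otimes\dots\otimes x_n=x_n'\,[\Gamma,\Gamma']$, where $\Gamma'=x_1',\dots,x_n'$ is a copy of $\Gamma=x_1,\dots,x_n$ (the class of $e$ if $n=0$). **Operators.** For $\mathcal X\subseteq\mathrm{Ob}(\mathbf{FA})$,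 let $\mathbb P(\mathcal X)$ be the closure of $\mathcal X$ under products of small families and $\mathbb S(\mathcal X)$ its closure under subprop-categories. Let $\mathbb U_{Sg}(\mathcal X)$ be the class of all $(\mathcal D,Q)\in\mathrm{Ob}(\mathbf{FA})$ such that, for every $\mathcal L^m$-theory $T$ over $Sg$ for which $(\mathcal C_T,P_T)$ is a subprop-category of $(\mathcal D,Q)$, we have $(\mathcal C_T,P_T)\in\mathcal X$. **Theorem.** For every class $\mathcal X\subseteq\mathrm{Ob}(\mathbf{FA})$ and every small signature $Sg$, $$\mathrm{Ob}(\mathbf{FA}^{Sg}_{(\cdot)})\circ\vDash^{Sg}_{(\cdot)}(\mathcal X)=\mathbb U_{Sg}\,\mathbb S\,\mathbb P(\mathcal X).$$ -/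

import Mathlib

universe u w

namespace Fibered

open CategoryTheory MonoidalCategory CartesianMonoidalCategory Opposite

/-! ### First-order syntax in context -/

/-- A first-order language: quantifier symbols, propositional connectives with arities, and the
designated connectives `e` (arity `0`) and `⊗` (arity `2`). -/
structure Language : Type (u + 1) where
  Quant : Type u
  Conn : ℕ → Type u
  e : Conn 0
  tensor : Conn 2

/-- A small multi-sorted signature.  All lists of sorts are written from right to left:
`σ₁, …, σₙ` is the list `[σₙ, …, σ₁]`. -/
structure Signature : Type (u + 1) where
  Srt : Type u
  Fn : Type u
  dom : Fn → List Srt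
  cod : Fn → Srt
  Rel : Type u
  ar : Rel → List Srt

/-- The variables of sort `τ` in a context.  A context `x₁ : σ₁, …, xₙ : σₙ` is considered up to
renaming of its variables, so it is just the list of its sorts (the head of the list is the last
entry of the context; `Γ, x : σ` is `σ :: Γ` and `Γ, Γ'` is `Γ' ++ Γ`). -/
inductive Var {S : Type u} : List S → S → Type u
  | zero {Γ : List S} {σ : S} : Var (σ :: Γ) σ
  | succ {Γ : List S} {σ τ : S} : Var Γ τ → Var (σ :: Γ) τ

/-- The positions of the last block of variables in `Γ, Δ`. -/
def Var.inl {S : Type u} {Γ : List S} : {Δ : List S} → {τ : S} → Var Δ τ → Var (Δ ++ Γ) τ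
  | _, _, .zero => .zero
  | _, _, .succ x => .succ (Var.inl x)

/-- The positions of the first block of variables in `Γ, Δ`. -/
def Var.inr {S : Type u} {Γ : List S} : (Δ : List S) → {τ : S} → Var Γ τ → Var (Δ ++ Γ) τ
  | [], _, x => x
  | _ :: Δ, _, x => .succ (Var.inr Δ x)

/-- Families over the variables of `Γ, Δ` from families over `Γ` and over `Δ`. -/
def Var.elim {S : Type u} {α : S → Type u} {Γ : List S} (g : ∀ τ, Var Γ τ → α τ) :
    (Δ : List S) → (∀ τ, Var Δ τ → α τ) → ∀ τ, Var (Δ ++ Γ) τ → α τ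
  | [], _, τ, x => g τ x
  | _ :: _, d, _, .zero => d _ .zero
  | _ :: Δ, d, τ, .succ x => Var.elim g Δ (fun τ y => d τ (.succ y)) τ x

/-- Terms in context, `M : τ [Γ]`. The arguments of a function symbol are a family of terms indexed
by the entries of its list of argument sorts. -/
inductive Term (Sg : Signature.{u}) (Γ : List Sg.Srt) : Sg.Srt → Type u
  | var {τ : Sg.Srt} (x : Var Γ τ) : Term Sg Γ τ
  | app (f : Sg.Fn) (M : ∀ σ, Var (Sg.dom f) σ → Term Sg Γ σ) : Term Sg Γ (Sg.cod f)

/-- Formulas in context, `φ : prop [Γ]`, up to renaming of bound variables. -/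
inductive Formula (ℒ : Language.{u}) (Sg : Signature.{u}) : List Sg.Srt → Type u
  | rel {Γ : List Sg.Srt} (R : Sg.Rel) (M : ∀ σ, Var (Sg.ar R) σ → Term Sg Γ σ) : Formula ℒ Sg Γ
  | eq {Γ : List Sg.Srt} {σ : Sg.Srt} (M N : Term Sg Γ σ) : Formula ℒ Sg Γ
  | conn {Γ : List Sg.Srt} {n : ℕ} (o : ℒ.Conn n) (φ : Fin n → Formula ℒ Sg Γ) : Formula ℒ Sg Γ
  | quant {Γ : List Sg.Srt} (Ω : ℒ.Quant) (σ : Sg.Srt) (φ : Formula ℒ Sg (σ :: Γ)) : Formula ℒ Sg Γ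

/-- Lists of terms in context `Γ`, one for each entry of `Δ`. -/
abbrev Sub (Sg : Signature.{u}) (Γ Δ : List Sg.Srt) : Type u := ∀ τ, Var Δ τ → Term Sg Γ τ

section

variable {ℒ : Language.{u}} {Sg : Signature.{u}}

/-- Simultaneous substitution in terms. -/
def Term.subst {Γ Δ : List Sg.Srt} (γ : Sub Sg Γ Δ) : {τ : Sg.Srt} → Term Sg Δ τ → Term Sg Γ τ
  | _, .var x => γ _ x
  | _, .app f M => .app f fun σ x => (M σ x).subst γ

/-- The identity substitution. -/
def Sub.id (Γ : List Sg.Srt) : Sub Sg Γ Γ := fun _ x => .var x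

/-- Composition of substitutions. -/
def Sub.comp {Γ Δ Θ : List Sg.Srt} (γ : Sub Sg Γ Δ) (δ : Sub Sg Δ Θ) : Sub Sg Γ Θ :=
  fun τ x => (δ τ x).subst γ

/-- The list of the variables of `Γ` in the context `Γ, Δ`. -/
def Sub.fst (Γ Δ : List Sg.Srt) : Sub Sg (Δ ++ Γ) Γ := fun _ x => .var (Var.inr Δ x)

/-- The list of the variables of `Δ` in the context `Γ, Δ`. -/
def Sub.snd (Γ Δ : List Sg.Srt) : Sub Sg (Δ ++ Γ) Δ := fun _ x => .var (Var.inl x)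

/-- Concatenation of lists of terms. -/
def Sub.pair {Θ Γ Δ : List Sg.Srt} (γ : Sub Sg Θ Γ) (δ : Sub Sg Θ Δ) : Sub Sg Θ (Δ ++ Γ) :=
  Var.elim γ Δ δ

/-- Extension of a substitution under a binder. -/
def Sub.up {Γ Δ : List Sg.Srt} (σ : Sg.Srt) (γ : Sub Sg Γ Δ) : Sub Sg (σ :: Γ) (σ :: Δ)
  | _, .zero => .var .zero
  | _, .succ x => (γ _ x).subst fun _ y => .var (.succ y)

/-- Simultaneous (capture avoiding) substitution in formulas. -/
def Formula.subst : {Δ : List Sg.Srt} → Formula ℒ Sg Δ → {Γ : List Sg.Srt} → Sub Sg Γ Δ →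
    Formula ℒ Sg Γ
  | _, .rel R M, _, γ => .rel R fun σ x => (M σ x).subst γ
  | _, .eq M N, _, γ => .eq (M.subst γ) (N.subst γ)
  | _, .conn o φ, _, γ => .conn o fun i => (φ i).subst γ
  | _, .quant Ω σ φ, _, γ => .quant Ω σ (φ.subst (γ.up σ))

/-- The formula `φ ⊗ ψ`. -/
def Formula.tens {Γ : List Sg.Srt} (φ ψ : Formula ℒ Sg Γ) : Formula ℒ Sg Γ :=
  .conn ℒ.tensor ![φ, ψ]

/-- The formula `e`. -/
def Formula.unit (Γ : List Sg.Srt) : Formula ℒ Sg Γ := .conn ℒ.e ![]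

/-- `Ω_{Γ'}(φ) [Γ] := Ω_{y₁} ⋯ Ω_{yₘ}(φ) [Γ]` for `Γ' = y₁, …, yₘ` and `φ [Γ, Γ']`. -/
def Formula.quants (Ω : ℒ.Quant) {Γ : List Sg.Srt} :
    (Γ' : List Sg.Srt) → Formula ℒ Sg (Γ' ++ Γ) → Formula ℒ Sg Γ
  | [], φ => φ
  | σ :: Γ', φ => Formula.quants Ω Γ' (.quant Ω σ φ)

/-- The formula `M₁ = N₁ ⊗ ⋯ ⊗ Mₙ = Nₙ` for two lists of terms; it is `e` for `n = 0`. -/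
def Formula.eqs {Γ : List Sg.Srt} :
    (Δ : List Sg.Srt) → Sub Sg Γ Δ → Sub Sg Γ Δ → Formula ℒ Sg Γ
  | [], _, _ => .unit Γ
  | _ :: Δ, γ, δ => .tens (Formula.eqs Δ (fun τ x => γ τ (.succ x)) (fun τ x => δ τ (.succ x)))
      (.eq (γ _ .zero) (δ _ .zero))

variable (ℒ Sg) in
/-- Assertions: equations in context and sequents in context. -/
inductive Assertion : Type u
  | eqn (Γ : List Sg.Srt) (τ : Sg.Srt) (M N : Term Sg Γ τ) : Assertion
  | seq (Γ : List Sg.Srt) (Φ : List (Formula ℒ Sg Γ)) (ψ : Formula ℒ Sg Γ) : Assertion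

variable (ℒ Sg) in
/-- Theories over the signature `Sg`, ordered by inclusion. -/
abbrev Theory : Type u := Set (Assertion ℒ Sg)

/-- `M = N : τ [Γ]` belongs to `T`. -/
def Theory.Eqn (T : Theory ℒ Sg) {Γ : List Sg.Srt} {τ : Sg.Srt} (M N : Term Sg Γ τ) : Prop :=
  Assertion.eqn Γ τ M N ∈ T

/-- `Φ ⊢ ψ [Γ]` belongs to `T`. -/
def Theory.Seq (T : Theory ℒ Sg) {Γ : List Sg.Srt} (Φ : List (Formula ℒ Sg Γ))
    (ψ : Formula ℒ Sg Γ) : Prop :=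
  Assertion.seq Γ Φ ψ ∈ T

/-- `T` is a theory of the minimal logic: it is closed under the rules of typed equational logic and
under the rules Ax, Cut, Cwk, Sub, Ω-Con, ◇-Cong, ⊗-Ref, e-Ref.  The substitution rules are stated
for the simultaneous substitution of lists of terms, i.e. for iterated single substitutions (and
context weakenings); a double line rule is stated as an equivalence. -/
structure Theory.IsMinimal (T : Theory ℒ Sg) : Prop where
  refl {Γ : List Sg.Srt} {τ : Sg.Srt} (M : Term Sg Γ τ) : T.Eqn M M
  symm {Γ : List Sg.Srt} {τ : Sg.Srt} {M N : Term Sg Γ τ} : T.Eqn M N → T.Eqn N M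
  trans {Γ : List Sg.Srt} {τ : Sg.Srt} {M N K : Term Sg Γ τ} : T.Eqn M N → T.Eqn N K → T.Eqn M K
  eqn_sub {Γ Δ : List Sg.Srt} {γ δ : Sub Sg Γ Δ} {τ : Sg.Srt} {M N : Term Sg Δ τ} :
    (∀ σ x, T.Eqn (γ σ x) (δ σ x)) → T.Eqn M N → T.Eqn (M.subst γ) (N.subst δ)
  ax {Γ : List Sg.Srt} (φ : Formula ℒ Sg Γ) : T.Seq [φ] φ
  cut {Γ : List Sg.Srt} {φ ψ θ : Formula ℒ Sg Γ} : T.Seq [φ] ψ → T.Seq [ψ] θ → T.Seq [φ] θ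
  cwk {Γ : List Sg.Srt} (σ : Sg.Srt) {Φ : List (Formula ℒ Sg Γ)} {ψ : Formula ℒ Sg Γ} :
    T.Seq Φ ψ → T.Seq (Φ.map fun φ => φ.subst (Sub.fst Γ [σ])) (ψ.subst (Sub.fst Γ [σ]))
  sub {Γ Δ : List Sg.Srt} {γ δ : Sub Sg Γ Δ} {Φ : List (Formula ℒ Sg Δ)} {ψ : Formula ℒ Sg Δ} :
    (∀ σ x, T.Eqn (γ σ x) (δ σ x)) → T.Seq Φ ψ →
      T.Seq (Φ.map fun φ => φ.subst γ) (ψ.subst δ)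
  quant_con {Γ : List Sg.Srt} (Ω : ℒ.Quant) (σ : Sg.Srt) {φ ψ : Formula ℒ Sg (σ :: Γ)} :
    T.Seq [φ] ψ → T.Seq [ψ] φ → T.Seq [.quant Ω σ φ] (.quant Ω σ ψ)
  conn_cong {Γ : List Sg.Srt} {n : ℕ} (o : ℒ.Conn n) {φ ψ : Fin n → Formula ℒ Sg Γ} :
    (∀ i, T.Seq [φ i] (ψ i)) → (∀ i, T.Seq [ψ i] (φ i)) → T.Seq [.conn o φ] (.conn o ψ)
  tens_ref {Γ : List Sg.Srt} (Φ Ψ : List (Formula ℒ Sg Γ)) (α β θ : Formula ℒ Sg Γ) :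
    T.Seq (Φ ++ α :: β :: Ψ) θ ↔ T.Seq (Φ ++ α.tens β :: Ψ) θ
  unit_ref {Γ : List Sg.Srt} (Φ Ψ : List (Formula ℒ Sg Γ)) (θ : Formula ℒ Sg Γ) :
    T.Seq (Φ ++ Formula.unit Γ :: Ψ) θ ↔ T.Seq (Φ ++ Ψ) θ

end

/-! ### Prop-categories -/

/-- A prop-category: a (locally small, possibly large) category with designated finite products and
a contravariant functor to partially ordered sets and monotone maps. -/
structure PropCategory : Type (max (u + 1) (w + 1)) where
  Base : Type w
  [cat : Category.{u} Base]
  [cart : CartesianMonoidalCategory Base]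
  P : Baseᵒᵖ ⥤ PartOrd.{u}

attribute [instance] PropCategory.cat PropCategory.cart

/-- The poset `P(c)`. -/
abbrev PropCategory.Fib (D : PropCategory.{u, w}) (c : D.Base) : Type u := D.P.obj (op c)

/-- The monotone map `P(f)`. -/
abbrev PropCategory.re (D : PropCategory.{u, w}) {b c : D.Base} (f : b ⟶ c) (r : D.Fib c) :
    D.Fib b := D.P.map f.op r

/-- The prop-categories that interpret the language `ℒ` (the objects of `FA`). -/
structure FA (ℒ : Language.{u}) : Type (max (u + 1) (w + 1)) extends PropCategory.{u, w} where
  /-- each `P(c)` is an algebra for the connectives -/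
  conn {n : ℕ} (o : ℒ.Conn n) (c : Base) : (Fin n → toPropCategory.Fib c) → toPropCategory.Fib c
  re_conn {n : ℕ} (o : ℒ.Conn n) {b c : Base} (f : b ⟶ c) (r : Fin n → toPropCategory.Fib c) :
    toPropCategory.re f (conn o c r) = conn o b fun i => toPropCategory.re f (r i)
  /-- the designated element `Eq_c ∈ P(c × c)` -/
  Eq (c : Base) : toPropCategory.Fib (c ⊗ c)
  /-- the maps `Ω_{b,c} : P(b × c) → P(b)`, natural in `b` -/
  quant (Ω : ℒ.Quant) (b c : Base) : toPropCategory.Fib (b ⊗ c) → toPropCategory.Fib b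
  quant_nat (Ω : ℒ.Quant) {b b' : Base} (f : b' ⟶ b) (c : Base) (r : toPropCategory.Fib (b ⊗ c)) :
    quant Ω b' c (toPropCategory.re (f ▷ c) r) = toPropCategory.re f (quant Ω b c r)
  /-- `(P(c), ⊗, e)` is a monoid -/
  tens_assoc {c : Base} (r s t : toPropCategory.Fib c) :
    conn ℒ.tensor c ![conn ℒ.tensor c ![r, s], t] = conn ℒ.tensor c ![r, conn ℒ.tensor c ![s, t]]
  unit_tens {c : Base} (r : toPropCategory.Fib c) : conn ℒ.tensor c ![conn ℒ.e c ![], r] = r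
  tens_unit {c : Base} (r : toPropCategory.Fib c) : conn ℒ.tensor c ![r, conn ℒ.e c ![]] = r
  quant_one (Ω : ℒ.Quant) {b : Base} (r : toPropCategory.Fib b) :
    quant Ω b (𝟙_ Base) (toPropCategory.re (fst b (𝟙_ Base)) r) = r
  quant_prod (Ω : ℒ.Quant) {b c d : Base} (r : toPropCategory.Fib ((b ⊗ c) ⊗ d)) :
    quant Ω b (c ⊗ d) (toPropCategory.re (α_ b c d).inv r) = quant Ω b c (quant Ω (b ⊗ c) d r)
  Eq_one : Eq (𝟙_ Base) = conn ℒ.e (𝟙_ Base ⊗ 𝟙_ Base) ![]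
  Eq_prod (c₁ c₂ : Base) : Eq (c₁ ⊗ c₂) = conn ℒ.tensor ((c₁ ⊗ c₂) ⊗ (c₁ ⊗ c₂))
    ![toPropCategory.re (lift (fst (c₁ ⊗ c₂) (c₁ ⊗ c₂) ≫ fst c₁ c₂)
        (snd (c₁ ⊗ c₂) (c₁ ⊗ c₂) ≫ fst c₁ c₂)) (Eq c₁),
      toPropCategory.re (lift (fst (c₁ ⊗ c₂) (c₁ ⊗ c₂) ≫ snd c₁ c₂)
        (snd (c₁ ⊗ c₂) (c₁ ⊗ c₂) ≫ snd c₁ c₂)) (Eq c₂)]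

/-- A morphism `F = (Fᵒ, Fᵖ)` of `FA`: a product preserving functor `Fᵒ` and a natural transformation
`Fᵖ : P ⟶ Q ∘ Fᵒ` compatible with connectives, quantifiers and equality. Here
`prodComparison Fᵒ b c : Fᵒ (b × c) ⟶ Fᵒ b × Fᵒ c` is the change-in-product isomorphism. -/
structure FA.Hom {ℒ : Language.{u}} (D E : FA.{u, w} ℒ) where
  o : D.Base ⥤ E.Base
  [preserves : Limits.PreservesFiniteProducts o]
  p : D.P ⟶ o.op ⋙ E.P
  map_conn {n : ℕ} (k : ℒ.Conn n) (c : D.Base) (r : Fin n → D.Fib c) :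
    p.app (op c) (D.conn k c r) = E.conn k (o.obj c) fun i => p.app (op c) (r i)
  map_quant (Ω : ℒ.Quant) (b c : D.Base) (r : D.Fib (b ⊗ c)) :
    p.app (op b) (D.quant Ω b c r) =
      E.quant Ω (o.obj b) (o.obj c) (E.re (inv (prodComparison o b c)) (p.app (op (b ⊗ c)) r))
  map_Eq (c : D.Base) :
    p.app (op (c ⊗ c)) (D.Eq c) = E.re (prodComparison o c c) (E.Eq (o.obj c))

/-- `ι` is a subprop-morphism: `ιᵒ` is faithful and each `ιᵖ_c` is an order embedding. -/
def FA.Hom.IsSubprop {ℒ : Language.{u}} {D E : FA.{u, w} ℒ} (ι : FA.Hom D E) : Prop :=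
  ι.o.Faithful ∧ ∀ (c : D.Base) (r s : D.Fib c), ι.p.app (op c) r ≤ ι.p.app (op c) s ↔ r ≤ s

/-- `D` is a subprop-category of `E`. -/
def FA.IsSubpropCategory {ℒ : Language.{u}} (D E : FA.{u, w} ℒ) : Prop :=
  ∃ ι : FA.Hom D E, ι.IsSubprop

/-! ### Structures and satisfaction -/

section

variable {ℒ : Language.{u}} {Sg : Signature.{u}}

/-- The designated product `s σ₁ × ⋯ × s σₙ` for a context `σ₁, …, σₙ`: it is `1` for `n = 0` and
`s σ₁` for `n = 1`. -/
def PropCategory.ctx (D : PropCategory.{u, w}) {S : Type u} (s : S → D.Base) : List S → D.Base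
  | [] => 𝟙_ D.Base
  | [σ] => s σ
  | σ :: τ :: Γ => D.ctx s (τ :: Γ) ⊗ s σ

/-- The projections of a designated product. -/
def PropCategory.proj (D : PropCategory.{u, w}) {S : Type u} (s : S → D.Base) :
    (Γ : List S) → {τ : S} → Var Γ τ → (D.ctx s Γ ⟶ s τ)
  | [_], _, .zero => 𝟙 _
  | _ :: _ :: _, _, .zero => snd _ _
  | _ :: τ :: Γ, _, .succ x => fst _ _ ≫ D.proj s (τ :: Γ) x

/-- The morphism `⟨f₁, …, fₙ⟩` into a designated product. -/
def PropCategory.tuple (D : PropCategory.{u, w}) {S : Type u} (s : S → D.Base) {c : D.Base} :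
    (Γ : List S) → (∀ τ, Var Γ τ → (c ⟶ s τ)) → (c ⟶ D.ctx s Γ)
  | [], _ => toUnit c
  | [_], f => f _ .zero
  | _ :: τ :: Γ, f => lift (D.tuple s (τ :: Γ) fun σ x => f σ (.succ x)) (f _ .zero)

/-- The change-in-product isomorphism `⟦Γ⟧ × ⟦σ⟧ ⟶ ⟦Γ, x : σ⟧`. -/
def PropCategory.snoc (D : PropCategory.{u, w}) {S : Type u} (s : S → D.Base) (Γ : List S) (σ : S) :
    D.ctx s Γ ⊗ s σ ⟶ D.ctx s (σ :: Γ) :=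
  D.tuple s (σ :: Γ) fun
    | _, .zero => snd _ _
    | _, .succ x => fst _ _ ≫ D.proj s Γ x

/-- An `Sg`-structure in the prop-category `D`. -/
structure Struc (Sg : Signature.{u}) (D : FA.{u, w} ℒ) where
  srt : Sg.Srt → D.Base
  fn (f : Sg.Fn) : D.ctx srt (Sg.dom f) ⟶ srt (Sg.cod f)
  rel (R : Sg.Rel) : D.Fib (D.ctx srt (Sg.ar R))

variable {D : FA.{u, w} ℒ}

/-- The interpretation `⟦M : τ [Γ]⟧` of terms. -/
def Struc.term (S : Struc Sg D) {Γ : List Sg.Srt} :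
    {τ : Sg.Srt} → Term Sg Γ τ → (D.ctx S.srt Γ ⟶ S.srt τ)
  | _, .var x => D.proj S.srt Γ x
  | _, .app f M => D.tuple S.srt (Sg.dom f) (fun σ x => S.term (M σ x)) ≫ S.fn f

/-- The interpretation `⟦φ [Γ]⟧` of formulas. -/
def Struc.form (S : Struc Sg D) : {Γ : List Sg.Srt} → Formula ℒ Sg Γ → D.Fib (D.ctx S.srt Γ)
  | _, .rel R M => D.re (D.tuple S.srt (Sg.ar R) fun σ x => S.term (M σ x)) (S.rel R)
  | _, .eq M N => D.re (lift (S.term M) (S.term N)) (D.Eq _)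
  | _, .conn o φ => D.conn o _ fun i => S.form (φ i)
  | Γ, .quant Ω σ φ => D.quant Ω (D.ctx S.srt Γ) (S.srt σ) (D.re (D.snoc S.srt Γ σ) (S.form φ))

/-- `r₁ ⊗ ⋯ ⊗ rₙ` in `P(c)`, which is `e` for `n = 0`. -/
def FA.bigTens (D : FA.{u, w} ℒ) {c : D.Base} : List (D.Fib c) → D.Fib c
  | [] => D.conn ℒ.e c ![]
  | r :: l => D.conn ℒ.tensor c ![r, D.bigTens l]

/-- Satisfaction of assertions. -/
def Struc.Sat (S : Struc Sg D) : Assertion ℒ Sg → Prop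
  | .eqn _ _ M N => S.term M = S.term N
  | .seq _ Φ ψ => D.bigTens (Φ.map S.form) ≤ S.form ψ

/-- The theory `Th(S)` of a structure. -/
def Struc.Th (S : Struc Sg D) : Theory ℒ Sg := {a | S.Sat a}

/-- Semantic consequence `T ⊨_𝒳 T'` between `Sg`-theories. -/
def Entails (𝒳 : Set (FA.{u, w} ℒ)) (T T' : Theory ℒ Sg) : Prop :=
  ∀ D ∈ 𝒳, ∀ S : Struc Sg D, T ⊆ S.Th → T' ⊆ S.Th

variable (Sg) in
/-- The logic `⊨_𝒳` restricted to `Sg`, as a closure operator on the lattice of `Sg`-theories: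
the closure of `T` is the largest `T'` with `T ⊨_𝒳 T'`. -/
def semLogic (𝒳 : Set (FA.{u, w} ℒ)) : ClosureOperator (Theory ℒ Sg) :=
  .mk₂ (fun T => {a | Entails 𝒳 T {a}})
    (fun _ a ha _ _ _ h => Set.singleton_subset_iff.2 (h ha))
    (fun _ _ h _ ha D hD S hS => ha D hD S fun _ hb => h hb D hD S hS rfl)

/-- The class of all prop-categories with respect to which the logic `L` on `Sg`-theories is
sound. -/
def soundClass (L : ClosureOperator (Theory ℒ Sg)) : Set (FA.{u, w} ℒ) :=
  {D | ∀ T T' : Theory ℒ Sg, T' ⊆ L T → Entails {D} T T'}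

end

/-! ### Products of prop-categories -/

section

variable {ℒ : Language.{u}} {I : Type u}

/-- Componentwise finite products in a product of categories. -/
instance piCartesian (C : I → Type w) [∀ i, Category.{u} (C i)]
    [∀ i, CartesianMonoidalCategory (C i)] : CartesianMonoidalCategory (∀ i, C i) where
  isTerminalTensorUnit := Limits.IsTerminal.ofUniqueHom (fun X i => toUnit (X i))
    fun X m => funext fun i => toUnit_unique _ _
  fst X Y i := fst (X i) (Y i)
  snd X Y i := snd (X i) (Y i)
  fst_def X Y := funext fun i => fst_def (X i) (Y i)
  snd_def X Y := funext fun i => snd_def (X i) (Y i)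
  tensorProductIsBinaryProduct X Y := Limits.BinaryFan.IsLimit.mk _
    (fun f g i => lift (f i) (g i)) (fun f g => funext fun i => lift_fst _ _)
    (fun f g => funext fun i => lift_snd _ _)
    (fun f g m h₁ h₂ => funext fun i => hom_ext _ _
      (((congrFun h₁ i).trans (lift_fst (f i) (g i)).symm))
      (((congrFun h₂ i).trans (lift_snd (f i) (g i)).symm)))

theorem piCartesian_lift {C : I → Type w} [∀ i, Category.{u} (C i)]
    [∀ i, CartesianMonoidalCategory (C i)] {X Y Z : ∀ i, C i} (f : X ⟶ Y) (g : X ⟶ Z) (i : I) :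
    lift f g i = lift (f i) (g i) :=
  hom_ext _ _ ((congrFun (lift_fst f g) i).trans (lift_fst (f i) (g i)).symm)
    ((congrFun (lift_snd f g) i).trans (lift_snd (f i) (g i)).symm)

/-- The product `∏ᵢ (𝒞ᵢ, Pᵢ)`; all of its structure is componentwise. For empty `I` it is the
terminal prop-category. -/
def PropCategory.pi (D : I → PropCategory.{u, max u w}) : PropCategory.{u, max u w} where
  Base := ∀ i, (D i).Base
  cat := inferInstance
  cart := piCartesian fun i => (D i).Base
  P :=
    { obj := fun a => PartOrd.of (∀ i, (D i).Fib (a.unop i))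
      map := fun {a b} f => PartOrd.ofHom (X := ∀ i, (D i).Fib (a.unop i))
        (Y := ∀ i, (D i).Fib (b.unop i))
        ⟨fun r i => (D i).re (f.unop i) (r i), fun _ _ h i =>
          ((D i).P.map (f.unop i).op).hom.monotone (h i)⟩
      map_id := fun a => by
        ext r i
        exact ConcreteCategory.congr_hom ((D i).P.map_id (op (a.unop i))) (r i)
      map_comp := fun {a b c} f g => by
        ext r i
        exact ConcreteCategory.congr_hom ((D i).P.map_comp (f.unop i).op (g.unop i).op) (r i) }

theorem FA.conn₀ (D : FA.{u, w} ℒ) {c : D.Base} (o : ℒ.Conn 0) (x : Fin 0 → D.Fib c) :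
    D.conn o c x = D.conn o c ![] :=
  congrArg _ (funext fun k => k.elim0)

theorem FA.conn₂ (D : FA.{u, w} ℒ) {c : D.Base} (o : ℒ.Conn 2) {x : Fin 2 → D.Fib c}
    {r s : D.Fib c} (h₀ : x 0 = r) (h₁ : x 1 = s) : D.conn o c x = D.conn o c ![r, s] := by
  refine congrArg _ (funext fun k => ?_)
  fin_cases k
  exacts [h₀, h₁]

/-- The product of a small family in `FA`. -/
def FA.pi (D : I → FA.{u, max u w} ℒ) : FA.{u, max u w} ℒ where
  toPropCategory := PropCategory.pi.{u, w} fun i => (D i).toPropCategory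
  conn o c r := fun i => (D i).conn o (c i) fun k => r k i
  re_conn o b c f r := funext fun i => (D i).re_conn o (f i) fun k => r k i
  Eq c := fun i => (D i).Eq (c i)
  quant Ω b c r := fun i => (D i).quant Ω (b i) (c i) (r i)
  quant_nat Ω b b' f c r := funext fun i => (D i).quant_nat Ω (f i) (c i) (r i)
  tens_assoc r s t := funext fun i => by
    refine ((D i).conn₂ _ ((D i).conn₂ _ rfl rfl) rfl).trans
      (((D i).tens_assoc (r i) (s i) (t i)).trans ?_)
    symm
    exact (D i).conn₂ _ rfl ((D i).conn₂ _ rfl rfl)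
  unit_tens r := funext fun i =>
    ((D i).conn₂ _ ((D i).conn₀ _ _) rfl).trans ((D i).unit_tens (r i))
  tens_unit r := funext fun i =>
    ((D i).conn₂ _ rfl ((D i).conn₀ _ _)).trans ((D i).tens_unit (r i))
  quant_one Ω b r := funext fun i => (D i).quant_one Ω (r i)
  quant_prod Ω b c d r := funext fun i => (D i).quant_prod Ω (r i)
  Eq_one := funext fun i => (D i).Eq_one.trans ((D i).conn₀ _ _).symm
  Eq_prod c₁ c₂ := funext fun i => by
    refine ((D i).Eq_prod (c₁ i) (c₂ i)).trans ?_
    symm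
    exact (D i).conn₂ _
      (congrArg (fun f => (D i).re f ((D i).Eq (c₁ i)))
        (piCartesian_lift (C := fun i => (D i).Base) _ _ i))
      (congrArg (fun f => (D i).re f ((D i).Eq (c₂ i)))
        (piCartesian_lift (C := fun i => (D i).Base) _ _ i))

end

/-! ### Substitution lemmas -/

section

variable {ℒ : Language.{u}} {Sg : Signature.{u}}

theorem Term.subst_id {Γ : List Sg.Srt} {τ : Sg.Srt} (M : Term Sg Γ τ) :
    M.subst (Sub.id Γ) = M := by
  induction M with
  | var x => rfl
  | app f M ih => exact congrArg _ (funext fun σ => funext fun x => ih σ x)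

theorem Term.subst_subst {Θ Γ Δ : List Sg.Srt} (γ : Sub Sg Θ Γ) (δ : Sub Sg Γ Δ) {τ : Sg.Srt}
    (M : Term Sg Δ τ) : (M.subst δ).subst γ = M.subst (γ.comp δ) := by
  induction M with
  | var x => rfl
  | app f M ih => exact congrArg _ (funext fun σ => funext fun x => ih σ x)

theorem Sub.up_id (Γ : List Sg.Srt) (σ : Sg.Srt) : (Sub.id (Sg := Sg) Γ).up σ = Sub.id _ := by
  funext τ x
  cases x <;> rfl

theorem Sub.up_comp {Θ Γ Δ : List Sg.Srt} (σ : Sg.Srt) (γ : Sub Sg Θ Γ) (δ : Sub Sg Γ Δ) :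
    (γ.comp δ).up σ = (γ.up σ).comp (δ.up σ) := by
  funext τ x
  cases x with
  | zero => rfl
  | succ x =>
    refine (Term.subst_subst _ _ _).trans ?_
    symm
    exact Term.subst_subst _ _ _

theorem Formula.subst_id {Γ : List Sg.Srt} (φ : Formula ℒ Sg Γ) : φ.subst (Sub.id Γ) = φ := by
  induction φ with
  | rel R M => exact congrArg _ (funext fun σ => funext fun x => Term.subst_id _)
  | eq M N => exact congrArg₂ _ (Term.subst_id _) (Term.subst_id _)
  | conn o φ ih => exact congrArg _ (funext fun i => ih i)
  | quant Ω σ φ ih => exact congrArg _ ((congrArg _ (Sub.up_id _ _)).trans ih)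

theorem Formula.subst_subst {Δ : List Sg.Srt} (φ : Formula ℒ Sg Δ) {Θ Γ : List Sg.Srt}
    (γ : Sub Sg Θ Γ) (δ : Sub Sg Γ Δ) : (φ.subst δ).subst γ = φ.subst (γ.comp δ) := by
  induction φ generalizing Θ Γ with
  | rel R M => exact congrArg _ (funext fun σ => funext fun x => Term.subst_subst _ _ _)
  | eq M N => exact congrArg₂ _ (Term.subst_subst _ _ _) (Term.subst_subst _ _ _)
  | conn o φ ih => exact congrArg _ (funext fun i => ih i _ _)
  | quant Ω σ φ ih =>
    exact congrArg _ ((ih _ _).trans (congrArg _ (Sub.up_comp _ _ _).symm))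

theorem Formula.subst_tens {Γ Δ : List Sg.Srt} (φ ψ : Formula ℒ Sg Δ) (γ : Sub Sg Γ Δ) :
    (φ.tens ψ).subst γ = (φ.subst γ).tens (ψ.subst γ) := by
  refine congrArg (Formula.conn _) (funext fun i => ?_)
  fin_cases i <;> rfl

theorem Formula.subst_unit {Γ Δ : List Sg.Srt} (γ : Sub Sg Γ Δ) :
    (Formula.unit (ℒ := ℒ) Δ).subst γ = .unit Γ :=
  congrArg (Formula.conn _) (funext fun i => i.elim0)

theorem Formula.subst_eqs {Θ Γ : List Sg.Srt} (ε : Sub Sg Θ Γ) : (Δ : List Sg.Srt) →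
    (γ δ : Sub Sg Γ Δ) → (Formula.eqs (ℒ := ℒ) Δ γ δ).subst ε = .eqs Δ (ε.comp γ) (ε.comp δ)
  | [], _, _ => Formula.subst_unit _
  | _ :: Δ, _, _ => (Formula.subst_tens _ _ _).trans
      (congrArg₂ _ (Formula.subst_eqs ε Δ _ _) rfl)

@[simp] theorem Var.elim_inl {S : Type u} {α : S → Type u} {Γ : List S} (g : ∀ τ, Var Γ τ → α τ) :
    {Δ : List S} → (d : ∀ τ, Var Δ τ → α τ) → {τ : S} → (x : Var Δ τ) →
      Var.elim g Δ d τ (Var.inl x) = d τ x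
  | _, _, _, .zero => rfl
  | _, d, _, .succ x => Var.elim_inl g (fun τ y => d τ (.succ y)) x

@[simp] theorem Var.elim_inr {S : Type u} {α : S → Type u} {Γ : List S} (g : ∀ τ, Var Γ τ → α τ) :
    (Δ : List S) → (d : ∀ τ, Var Δ τ → α τ) → {τ : S} → (x : Var Γ τ) →
      Var.elim g Δ d τ (Var.inr Δ x) = g τ x
  | [], _, _, _ => rfl
  | _ :: Δ, d, _, x => Var.elim_inr g Δ (fun τ y => d τ (.succ y)) x

theorem Var.append_cases {S : Type u} {Γ : List S} : (Δ : List S) → {τ : S} →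
    (x : Var (Δ ++ Γ) τ) → (∃ y : Var Δ τ, x = Var.inl y) ∨ ∃ y : Var Γ τ, x = Var.inr Δ y
  | [], _, x => .inr ⟨x, rfl⟩
  | _ :: _, _, .zero => .inl ⟨.zero, rfl⟩
  | _ :: Δ, _, .succ x => (Var.append_cases Δ x).imp
      (fun ⟨y, h⟩ => ⟨.succ y, congrArg _ h⟩) fun ⟨y, h⟩ => ⟨y, congrArg _ h⟩

end

/-! ### Iterated quantifiers and substitution -/

section

variable {ℒ : Language.{u}} {Sg : Signature.{u}}

/-- Extension of a substitution by the variables of `Δ`. -/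
def Sub.ups {Γ Γ' : List Sg.Srt} (γ : Sub Sg Γ Γ') :
    (Δ : List Sg.Srt) → Sub Sg (Δ ++ Γ) (Δ ++ Γ')
  | [] => γ
  | σ :: Δ => (Sub.ups γ Δ).up σ

theorem Sub.ups_inr {Γ Γ' : List Sg.Srt} (γ : Sub Sg Γ Γ') : (Δ : List Sg.Srt) → {τ : Sg.Srt} →
    (x : Var Γ' τ) → γ.ups Δ τ (Var.inr Δ x) = (γ τ x).subst (Sub.fst Γ Δ)
  | [], _, _ => (Term.subst_id _).symm
  | _ :: Δ, _, x => (congrArg _ (Sub.ups_inr γ Δ x)).trans (Term.subst_subst _ _ _)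

theorem Sub.ups_inl {Γ Γ' : List Sg.Srt} (γ : Sub Sg Γ Γ') : {Δ : List Sg.Srt} → {τ : Sg.Srt} →
    (x : Var Δ τ) → γ.ups Δ τ (Var.inl x) = .var (Var.inl x)
  | _, _, .zero => rfl
  | _, _, .succ x => congrArg (Term.subst _) (Sub.ups_inl γ x)

theorem Formula.quants_subst (Ω : ℒ.Quant) {Γ Γ' : List Sg.Srt} (γ : Sub Sg Γ Γ') :
    (Δ : List Sg.Srt) → (φ : Formula ℒ Sg (Δ ++ Γ')) →
      Formula.quants Ω Δ (φ.subst (γ.ups Δ)) = (Formula.quants Ω Δ φ).subst γ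
  | [], _ => rfl
  | σ :: Δ, φ => Formula.quants_subst Ω γ Δ (.quant Ω σ φ)

/-- The variables of `(Γ, Δ), Θ` in the context `Γ, (Δ, Θ)`. -/
def Sub.assoc (Γ Δ : List Sg.Srt) : (Θ : List Sg.Srt) → Sub Sg ((Θ ++ Δ) ++ Γ) (Θ ++ (Δ ++ Γ))
  | [] => Sub.id _
  | σ :: Θ => (Sub.assoc Γ Δ Θ).up σ

theorem Sub.assoc_inl (Γ Δ : List Sg.Srt) : {Θ : List Sg.Srt} → {τ : Sg.Srt} → (x : Var Θ τ) →
    Sub.assoc Γ Δ Θ τ (Var.inl x) = .var (Var.inl (Var.inl x))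
  | _, _, .zero => rfl
  | _, _, .succ x => congrArg (Term.subst _) (Sub.assoc_inl Γ Δ x)

theorem Sub.assoc_inr_inl (Γ Δ : List Sg.Srt) : (Θ : List Sg.Srt) → {τ : Sg.Srt} →
    (x : Var Δ τ) → Sub.assoc Γ Δ Θ τ (Var.inr Θ (Var.inl x)) = .var (Var.inl (Var.inr Θ x))
  | [], _, _ => rfl
  | _ :: Θ, _, x => congrArg (Term.subst _) (Sub.assoc_inr_inl Γ Δ Θ x)

theorem Sub.assoc_inr_inr (Γ Δ : List Sg.Srt) : (Θ : List Sg.Srt) → {τ : Sg.Srt} →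
    (x : Var Γ τ) → Sub.assoc Γ Δ Θ τ (Var.inr Θ (Var.inr Δ x)) = .var (Var.inr (Θ ++ Δ) x)
  | [], _, _ => rfl
  | _ :: Θ, _, x => congrArg (Term.subst _) (Sub.assoc_inr_inr Γ Δ Θ x)

theorem Formula.quants_assoc (Ω : ℒ.Quant) (Γ Δ : List Sg.Srt) :
    (Θ : List Sg.Srt) → (φ : Formula ℒ Sg (Θ ++ (Δ ++ Γ))) →
      Formula.quants Ω (Θ ++ Δ) (φ.subst (Sub.assoc Γ Δ Θ)) =
        Formula.quants Ω Δ (Formula.quants Ω Θ φ)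
  | [], φ => congrArg (Formula.quants Ω Δ) (Formula.subst_id φ)
  | σ :: Θ, φ => Formula.quants_assoc Ω Γ Δ Θ (.quant Ω σ φ)

end

/-! ### The classifying prop-category of a theory -/

section

variable {ℒ : Language.{u}} {Sg : Signature.{u}} {T : Theory ℒ Sg} (hT : T.IsMinimal)

/-- Lists of terms in context, up to provable equality of their entries. -/
abbrev Theory.IsMinimal.subSetoid (Γ Δ : List Sg.Srt) : Setoid (Sub Sg Γ Δ) where
  r γ δ := ∀ σ x, T.Eqn (γ σ x) (δ σ x)
  iseqv := ⟨fun _ _ _ => hT.refl _, fun h σ x => hT.symm (h σ x),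
    fun h k σ x => hT.trans (h σ x) (k σ x)⟩

/-- Formulas in context, up to provable equivalence. -/
abbrev Theory.IsMinimal.formSetoid (Γ : List Sg.Srt) : Setoid (Formula ℒ Sg Γ) where
  r φ ψ := T.Seq [φ] ψ ∧ T.Seq [ψ] φ
  iseqv := ⟨fun _ => ⟨hT.ax _, hT.ax _⟩, fun h => ⟨h.2, h.1⟩,
    fun h k => ⟨hT.cut h.1 k.1, hT.cut k.2 h.2⟩⟩

/-- `P_T(Γ)`: formulas in context up to provable equivalence, ordered by provability. -/
def ClForm (Γ : List Sg.Srt) : Type u := Quotient (hT.formSetoid Γ)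

/-- The class of a formula. -/
def ClForm.mk {Γ : List Sg.Srt} (φ : Formula ℒ Sg Γ) : ClForm hT Γ := Quotient.mk _ φ

theorem ClForm.mk_eq {Γ : List Sg.Srt} {φ ψ : Formula ℒ Sg Γ} :
    ClForm.mk hT φ = ClForm.mk hT ψ ↔ T.Seq [φ] ψ ∧ T.Seq [ψ] φ :=
  ⟨fun h => Quotient.exact h, fun h => Quotient.sound h⟩

variable {hT} in
theorem ClForm.exists_mk {Γ : List Sg.Srt} (r : ClForm hT Γ) : ∃ φ, ClForm.mk hT φ = r :=
  Quotient.exists_rep r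

instance (Γ : List Sg.Srt) : PartialOrder (ClForm hT Γ) where
  le := Quotient.lift₂ (fun φ ψ => T.Seq [φ] ψ) fun _ _ _ _ h k =>
    propext ⟨fun l => hT.cut h.2 (hT.cut l k.1), fun l => hT.cut h.1 (hT.cut l k.2)⟩
  le_refl := by
    rintro ⟨φ⟩
    exact hT.ax φ
  le_trans := by
    rintro ⟨φ⟩ ⟨ψ⟩ ⟨θ⟩ h k
    exact hT.cut h k
  le_antisymm := by
    rintro ⟨φ⟩ ⟨ψ⟩ h k
    exact Quotient.sound ⟨h, k⟩

theorem ClForm.mk_le {Γ : List Sg.Srt} {φ ψ : Formula ℒ Sg Γ} :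
    ClForm.mk hT φ ≤ ClForm.mk hT ψ ↔ T.Seq [φ] ψ := Iff.rfl

/-- Substitution on classes. -/
def ClForm.subst {Γ Δ : List Sg.Srt} (f : Quotient (hT.subSetoid Γ Δ)) (r : ClForm hT Δ) :
    ClForm hT Γ :=
  Quotient.map₂ (sc := hT.formSetoid Γ) (fun γ φ => φ.subst γ) (by
    intro γ δ h φ ψ k
    exact ⟨hT.sub h k.1, hT.sub (fun σ x => hT.symm (h σ x)) k.2⟩) f r

theorem ClForm.subst_mono {Γ Δ : List Sg.Srt} (f : Quotient (hT.subSetoid Γ Δ)) :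
    Monotone (ClForm.subst hT f) := by
  obtain ⟨γ, rfl⟩ := Quotient.exists_rep f
  rintro ⟨φ⟩ ⟨ψ⟩ h
  exact hT.sub (fun _ _ => hT.refl _) h

/-- The connectives on classes. -/
noncomputable def ClForm.conn {Γ : List Sg.Srt} {n : ℕ} (o : ℒ.Conn n) (r : Fin n → ClForm hT Γ) :
    ClForm hT Γ :=
  ClForm.mk hT (.conn o fun i => (r i).exists_mk.choose)

theorem ClForm.conn_mk {Γ : List Sg.Srt} {n : ℕ} (o : ℒ.Conn n) (φ : Fin n → Formula ℒ Sg Γ) :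
    (ClForm.conn hT o fun i => ClForm.mk hT (φ i)) = ClForm.mk hT (.conn o φ) := by
  have h := fun i => (ClForm.mk_eq hT).1 (ClForm.mk hT (φ i)).exists_mk.choose_spec
  exact (ClForm.mk_eq hT).2 ⟨hT.conn_cong o (fun i => (h i).1) fun i => (h i).2,
    hT.conn_cong o (fun i => (h i).2) fun i => (h i).1⟩

/-- The quantifiers on classes. -/
def ClForm.quants (Ω : ℒ.Quant) {Γ : List Sg.Srt} (Γ' : List Sg.Srt) :
    ClForm hT (Γ' ++ Γ) → ClForm hT Γ :=
  Quotient.map (Formula.quants Ω Γ') (by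
    induction Γ' with
    | nil => exact fun _ _ h => h
    | cons σ Γ' ih => exact fun _ _ h => ih ⟨hT.quant_con Ω σ h.1 h.2, hT.quant_con Ω σ h.2 h.1⟩)

/-- Objects of the classifying category: contexts up to renaming of variables. (The universe `w`
of the objects is a free parameter.) -/
structure ClCtx (hT : T.IsMinimal) : Type (max u w) where
  ctx : List Sg.Srt

instance : Category.{u} (ClCtx.{u, w} hT) where
  Hom X Y := Quotient (hT.subSetoid X.ctx Y.ctx)
  id X := Quotient.mk _ (Sub.id X.ctx)
  comp f g := Quotient.map₂ Sub.comp
    (fun γ γ' (h : ∀ σ x, T.Eqn (γ σ x) (γ' σ x)) δ δ' (k : ∀ σ x, T.Eqn (δ σ x) (δ' σ x)) σ x =>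
      hT.eqn_sub h (k σ x)) f g
  id_comp := by
    rintro X Y ⟨γ⟩
    exact congrArg (Quotient.mk _) (funext fun _ => funext fun _ => Term.subst_id _)
  comp_id := by
    rintro X Y ⟨γ⟩
    rfl
  assoc := by
    rintro X Y Z W ⟨γ⟩ ⟨δ⟩ ⟨ε⟩
    exact congrArg (Quotient.mk _) (funext fun _ => funext fun _ => (Term.subst_subst _ _ _).symm)

/-- The morphism given by a list of terms. -/
def ClCtx.hom {X Y : ClCtx.{u, w} hT} (γ : Sub Sg X.ctx Y.ctx) : X ⟶ Y := Quotient.mk _ γ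

variable {hT} in
theorem ClCtx.exists_hom {X Y : ClCtx.{u, w} hT} (f : X ⟶ Y) : ∃ γ, ClCtx.hom hT γ = f :=
  Quotient.exists_rep f

theorem ClCtx.hom_comp {X Y Z : ClCtx.{u, w} hT} (γ : Sub Sg X.ctx Y.ctx)
    (δ : Sub Sg Y.ctx Z.ctx) : ClCtx.hom hT γ ≫ ClCtx.hom hT δ = ClCtx.hom hT (γ.comp δ) := rfl

/-- The finite products of the classifying category: the empty context and concatenation. -/
instance : CartesianMonoidalCategory (ClCtx.{u, w} hT) :=
  .ofChosenFiniteProducts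
    { cone := Limits.asEmptyCone ⟨[]⟩
      isLimit := Limits.IsTerminal.ofUniqueHom (fun _ => Quotient.mk _ fun _ x => nomatch x) (by
        rintro X ⟨γ⟩
        exact congrArg (Quotient.mk _) (funext fun _ => funext fun x => nomatch x)) }
    fun X Y =>
      { cone := Limits.BinaryFan.mk (P := (⟨Y.ctx ++ X.ctx⟩ : ClCtx.{u, w} hT))
          (ClCtx.hom hT (Sub.fst X.ctx Y.ctx)) (ClCtx.hom hT (Sub.snd X.ctx Y.ctx))
        isLimit := Limits.BinaryFan.IsLimit.mk _
          (fun f g => Quotient.map₂ Sub.pair (by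
            intro γ γ' h δ δ' k σ x
            obtain ⟨y, rfl⟩ | ⟨y, rfl⟩ := Var.append_cases _ x
            · simpa only [Sub.pair, Var.elim_inl] using k σ y
            · simpa only [Sub.pair, Var.elim_inr] using h σ y) f g)
          (by
            rintro Z ⟨γ⟩ ⟨δ⟩
            exact congrArg (Quotient.mk _) (funext fun _ => funext fun x => Var.elim_inr _ _ _ _))
          (by
            rintro Z ⟨γ⟩ ⟨δ⟩
            exact congrArg (Quotient.mk _) (funext fun _ => funext fun x => Var.elim_inl _ _ _))
          (by
            rintro Z ⟨γ⟩ ⟨δ⟩ ⟨ε⟩ h k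
            refine Quotient.sound fun σ x => ?_
            obtain ⟨y, rfl⟩ | ⟨y, rfl⟩ := Var.append_cases _ x
            · rw [Sub.pair, Var.elim_inl]
              exact Quotient.exact k σ y
            · rw [Sub.pair, Var.elim_inr]
              exact Quotient.exact h σ y) }

variable {X Y Z W : ClCtx.{u, w} hT}

theorem ClCtx.fst_eq : fst X Y = ClCtx.hom hT (Sub.fst X.ctx Y.ctx) := rfl

theorem ClCtx.snd_eq : snd X Y = ClCtx.hom hT (Sub.snd X.ctx Y.ctx) := rfl

theorem ClCtx.lift_hom (γ : Sub Sg Z.ctx X.ctx) (δ : Sub Sg Z.ctx Y.ctx) :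
    lift (ClCtx.hom hT γ) (ClCtx.hom hT δ) = ClCtx.hom hT (X := Z) (Y := X ⊗ Y) (γ.pair δ) := by
  refine hom_ext _ _ ?_ ?_
  · refine (lift_fst _ _).trans (congrArg (Quotient.mk _) ?_)
    exact (funext fun _ => funext fun x => (Var.elim_inr _ _ _ _).symm)
  · refine (lift_snd _ _).trans (congrArg (Quotient.mk _) ?_)
    exact (funext fun _ => funext fun x => (Var.elim_inl _ _ _).symm)

theorem ClCtx.whiskerRight_hom (γ : Sub Sg X.ctx Y.ctx) :
    ClCtx.hom hT γ ▷ Z = ClCtx.hom hT (X := X ⊗ Z) (Y := Y ⊗ Z) (γ.ups Z.ctx) := by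
  refine hom_ext _ _ ?_ ?_
  · refine (whiskerRight_fst _ _).trans (congrArg (Quotient.mk _) ?_)
    exact (funext fun _ => funext fun x => (Sub.ups_inr γ _ x).symm)
  · refine (whiskerRight_snd _ _).trans (congrArg (Quotient.mk _) ?_)
    exact (funext fun _ => funext fun x => (Sub.ups_inl γ x).symm)

theorem ClCtx.associator_inv :
    (α_ X Y Z).inv = ClCtx.hom hT (X := X ⊗ (Y ⊗ Z)) (Y := (X ⊗ Y) ⊗ Z)
      (Sub.assoc X.ctx Y.ctx Z.ctx) := by
  refine hom_ext _ _ (hom_ext _ _ ?_ ?_) ?_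
  · refine (Category.assoc _ _ _).trans ((associator_inv_fst_fst _ _ _).trans
      (congrArg (Quotient.mk _) ?_))
    exact (funext fun _ => funext fun x => (Sub.assoc_inr_inr _ _ _ x).symm)
  · refine (Category.assoc _ _ _).trans ((associator_inv_fst_snd _ _ _).trans
      (congrArg (Quotient.mk _) ?_))
    exact (funext fun _ => funext fun x => (Sub.assoc_inr_inl _ _ _ x).symm)
  · refine (associator_inv_snd _ _ _).trans (congrArg (Quotient.mk _) ?_)
    exact (funext fun _ => funext fun x => (Sub.assoc_inl _ _ x).symm)

/-- The prop-category `(𝒞_T, P_T)` without its logical operations. -/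
def clPropCategory : PropCategory.{u, max u w} where
  Base := ClCtx.{u, w} hT
  P :=
    { obj := fun X => PartOrd.of (ClForm hT X.unop.ctx)
      map := fun {X Y} f => PartOrd.ofHom (X := ClForm hT X.unop.ctx) (Y := ClForm hT Y.unop.ctx)
        ⟨ClForm.subst hT f.unop, ClForm.subst_mono hT f.unop⟩
      map_id := fun X => by
        ext ⟨φ⟩
        exact congrArg (Quotient.mk _) (Formula.subst_id φ)
      map_comp := by
        rintro X Y Z ⟨⟨γ⟩⟩ ⟨⟨δ⟩⟩
        ext ⟨φ⟩
        exact congrArg (Quotient.mk _) (Formula.subst_subst φ δ γ).symm }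

theorem clPropCategory_re (γ : Sub Sg X.ctx Y.ctx) (φ : Formula ℒ Sg Y.ctx) :
    (clPropCategory.{u, w} hT).re (ClCtx.hom hT γ) (ClForm.mk hT φ) =
      ClForm.mk hT (φ.subst γ) := rfl

theorem ClForm.conn₂_mk {Γ : List Sg.Srt} (φ ψ : Formula ℒ Sg Γ) :
    ClForm.conn hT ℒ.tensor ![ClForm.mk hT φ, ClForm.mk hT ψ] = ClForm.mk hT (φ.tens ψ) := by
  rw [Formula.tens, ← ClForm.conn_mk]
  refine congrArg _ (funext fun k => ?_)
  fin_cases k <;> rfl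

theorem ClForm.conn₀_mk (Γ : List Sg.Srt) :
    ClForm.conn hT ℒ.e ![] = ClForm.mk hT (Formula.unit Γ) := by
  rw [Formula.unit, ← ClForm.conn_mk]
  exact congrArg _ (funext fun k => k.elim0)

theorem ClForm.tens_assoc {Γ : List Sg.Srt} (α β θ : Formula ℒ Sg Γ) :
    ClForm.mk hT ((α.tens β).tens θ) = ClForm.mk hT (α.tens (β.tens θ)) := by
  have key : ∀ ψ, T.Seq [(α.tens β).tens θ] ψ ↔ T.Seq [α.tens (β.tens θ)] ψ := fun ψ => by
    have h₁ := hT.tens_ref [] [] (α.tens β) θ ψ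
    have h₂ := hT.tens_ref [] [θ] α β ψ
    have h₃ := hT.tens_ref [] [] α (β.tens θ) ψ
    have h₄ := hT.tens_ref [α] [] β θ ψ
    exact h₁.symm.trans (h₂.symm.trans (h₄.trans h₃))
  exact (ClForm.mk_eq hT).2 ⟨(key _).2 (hT.ax _), (key _).1 (hT.ax _)⟩

theorem ClForm.unit_tens {Γ : List Sg.Srt} (φ : Formula ℒ Sg Γ) :
    ClForm.mk hT ((Formula.unit Γ).tens φ) = ClForm.mk hT φ := by
  have key : ∀ ψ, T.Seq [(Formula.unit Γ).tens φ] ψ ↔ T.Seq [φ] ψ := fun ψ =>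
    (hT.tens_ref [] [] _ φ ψ).symm.trans (hT.unit_ref [] [φ] ψ)
  exact (ClForm.mk_eq hT).2 ⟨(key _).2 (hT.ax _), (key _).1 (hT.ax _)⟩

theorem ClForm.tens_unit {Γ : List Sg.Srt} (φ : Formula ℒ Sg Γ) :
    ClForm.mk hT (φ.tens (Formula.unit Γ)) = ClForm.mk hT φ := by
  have key : ∀ ψ, T.Seq [φ.tens (Formula.unit Γ)] ψ ↔ T.Seq [φ] ψ := fun ψ =>
    (hT.tens_ref [] [] φ _ ψ).symm.trans (hT.unit_ref [φ] [] ψ)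
  exact (ClForm.mk_eq hT).2 ⟨(key _).2 (hT.ax _), (key _).1 (hT.ax _)⟩

theorem ClForm.tens_congr {Γ : List Sg.Srt} {φ φ' ψ ψ' : Formula ℒ Sg Γ}
    (h : ClForm.mk hT φ = ClForm.mk hT φ') (k : ClForm.mk hT ψ = ClForm.mk hT ψ') :
    ClForm.mk hT (φ.tens ψ) = ClForm.mk hT (φ'.tens ψ') := by
  rw [← ClForm.conn₂_mk, ← ClForm.conn₂_mk, h, k]

theorem ClForm.eqs_append {Θ Γ : List Sg.Srt} : (Δ : List Sg.Srt) → (γ δ : Sub Sg Θ (Δ ++ Γ)) →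
    ClForm.mk hT (Formula.eqs (Δ ++ Γ) γ δ) = ClForm.mk hT
      ((Formula.eqs Γ (fun τ x => γ τ (Var.inr Δ x)) (fun τ x => δ τ (Var.inr Δ x))).tens
        (Formula.eqs Δ (fun τ x => γ τ (Var.inl x)) (fun τ x => δ τ (Var.inl x))))
  | [], _, _ => (ClForm.tens_unit hT _).symm
  | _ :: Δ, _, _ => (ClForm.tens_congr hT (ClForm.eqs_append Δ _ _) rfl).trans
      (ClForm.tens_assoc hT _ _ _)

/-- `P_T(f)` as a map of `P_T(Γ)`. -/
def ClForm.re {X Y : ClCtx.{u, w} hT} (f : X ⟶ Y) : ClForm hT Y.ctx → ClForm hT X.ctx :=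
  ClForm.subst hT f

theorem ClForm.re_conn {n : ℕ} (o : ℒ.Conn n) (f : X ⟶ Y) (r : Fin n → ClForm hT Y.ctx) :
    ClForm.re hT f (ClForm.conn hT o r) = ClForm.conn hT o fun i => ClForm.re hT f (r i) := by
  obtain ⟨γ, rfl⟩ := ClCtx.exists_hom f
  choose φ hφ using fun i => (r i).exists_mk
  obtain rfl : (fun i => ClForm.mk hT (φ i)) = r := funext hφ
  rw [ClForm.conn_mk]
  exact (ClForm.conn_mk hT o fun i => (φ i).subst γ).symm

theorem ClForm.quant_nat (Ω : ℒ.Quant) (f : X ⟶ Y) (r : ClForm hT (Y ⊗ Z).ctx) :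
    ClForm.quants hT Ω (Γ := X.ctx) Z.ctx (ClForm.re hT (f ▷ Z) r) =
      ClForm.re hT f (ClForm.quants hT Ω (Γ := Y.ctx) Z.ctx r) := by
  obtain ⟨γ, rfl⟩ := ClCtx.exists_hom f
  obtain ⟨φ, rfl⟩ := ClForm.exists_mk r
  rw [ClCtx.whiskerRight_hom]
  exact congrArg (Quotient.mk _) (Formula.quants_subst Ω γ Z.ctx φ)

theorem ClForm.quant_prod (Ω : ℒ.Quant) (r : ClForm hT ((X ⊗ Y) ⊗ Z).ctx) :
    ClForm.quants hT Ω (Γ := X.ctx) (Y ⊗ Z).ctx (ClForm.re hT (α_ X Y Z).inv r) =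
      ClForm.quants hT Ω (Γ := X.ctx) Y.ctx (ClForm.quants hT Ω (Γ := (X ⊗ Y).ctx) Z.ctx r) := by
  obtain ⟨φ, rfl⟩ := ClForm.exists_mk r
  rw [ClCtx.associator_inv]
  exact congrArg (Quotient.mk _) (Formula.quants_assoc Ω X.ctx Y.ctx Z.ctx φ)

theorem ClForm.conn_assoc {Γ : List Sg.Srt} (r s t : ClForm hT Γ) :
    ClForm.conn hT ℒ.tensor ![ClForm.conn hT ℒ.tensor ![r, s], t] =
      ClForm.conn hT ℒ.tensor ![r, ClForm.conn hT ℒ.tensor ![s, t]] := by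
  obtain ⟨φ, rfl⟩ := ClForm.exists_mk r
  obtain ⟨ψ, rfl⟩ := ClForm.exists_mk s
  obtain ⟨θ, rfl⟩ := ClForm.exists_mk t
  simp only [ClForm.conn₂_mk]
  exact ClForm.tens_assoc hT φ ψ θ

theorem ClForm.conn_unit_left {Γ : List Sg.Srt} (r : ClForm hT Γ) :
    ClForm.conn hT ℒ.tensor ![ClForm.conn hT ℒ.e ![], r] = r := by
  obtain ⟨φ, rfl⟩ := ClForm.exists_mk r
  rw [ClForm.conn₀_mk, ClForm.conn₂_mk]
  exact ClForm.unit_tens hT φ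

theorem ClForm.conn_unit_right {Γ : List Sg.Srt} (r : ClForm hT Γ) :
    ClForm.conn hT ℒ.tensor ![r, ClForm.conn hT ℒ.e ![]] = r := by
  obtain ⟨φ, rfl⟩ := ClForm.exists_mk r
  rw [ClForm.conn₀_mk, ClForm.conn₂_mk]
  exact ClForm.tens_unit hT φ

/-- `Eq_Γ`, the class of `x₁ = x₁' ⊗ ⋯ ⊗ xₙ = xₙ' [Γ, Γ']` (of `e` for the empty context). -/
def ClForm.Eq (Γ : List Sg.Srt) : ClForm hT (Γ ++ Γ) :=
  ClForm.mk hT (.eqs Γ (Sub.fst Γ Γ) (Sub.snd Γ Γ))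

theorem ClForm.re_Eq (γ δ : Sub Sg Z.ctx X.ctx) :
    ClForm.re hT (lift (ClCtx.hom hT γ) (ClCtx.hom hT δ)) (ClForm.Eq hT X.ctx) =
      ClForm.mk hT (.eqs X.ctx γ δ) := by
  rw [ClCtx.lift_hom]
  refine congrArg (Quotient.mk _) ((Formula.subst_eqs _ _ _ _).trans (congrArg₂ _ ?_ ?_))
  · exact funext fun _ => funext fun x => Var.elim_inr _ _ _ _
  · exact funext fun _ => funext fun x => Var.elim_inl _ _ _

theorem ClForm.Eq_prod : ClForm.Eq hT (X ⊗ Y).ctx = ClForm.conn hT ℒ.tensor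
    ![ClForm.re hT (lift (fst (X ⊗ Y) (X ⊗ Y) ≫ fst X Y) (snd (X ⊗ Y) (X ⊗ Y) ≫ fst X Y))
        (ClForm.Eq hT X.ctx),
      ClForm.re hT (lift (fst (X ⊗ Y) (X ⊗ Y) ≫ snd X Y) (snd (X ⊗ Y) (X ⊗ Y) ≫ snd X Y))
        (ClForm.Eq hT Y.ctx)] := by
  simp only [ClCtx.fst_eq, ClCtx.snd_eq, ClCtx.hom_comp, ClForm.re_Eq, ClForm.conn₂_mk]
  exact ClForm.eqs_append hT Y.ctx _ _

/-- The classifying prop-category `(𝒞_T, P_T)` of a theory `T` of the minimal logic. -/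
noncomputable def classifying : FA.{u, max u w} ℒ where
  toPropCategory := clPropCategory.{u, w} hT
  conn o _ := ClForm.conn hT o
  re_conn o _ _ := ClForm.re_conn.{u, w} hT o
  Eq X := ClForm.Eq hT X.ctx
  quant Ω _ Y := ClForm.quants hT Ω Y.ctx
  quant_nat Ω _ _ f _ := ClForm.quant_nat.{u, w} hT Ω f
  tens_assoc := ClForm.conn_assoc hT
  unit_tens := ClForm.conn_unit_left hT
  tens_unit := ClForm.conn_unit_right hT
  quant_one Ω _ r := by
    obtain ⟨φ, rfl⟩ := ClForm.exists_mk r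
    exact congrArg (Quotient.mk _) (Formula.subst_id φ)
  quant_prod Ω _ _ _ := ClForm.quant_prod.{u, w} hT Ω
  Eq_one := (ClForm.conn₀_mk hT _).symm
  Eq_prod _ _ := ClForm.Eq_prod.{u, w} hT

end

/-! ### Closure operations on classes of prop-categories -/

section

variable {ℒ : Language.{u}}

/-- The smallest class that contains `𝒳` and is closed under products of small families. -/
inductive ProdClosure (𝒳 : Set (FA.{u, max u w} ℒ)) : FA.{u, max u w} ℒ → Prop
  | of {D : FA.{u, max u w} ℒ} : D ∈ 𝒳 → ProdClosure 𝒳 D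
  | pi {I : Type u} (D : I → FA.{u, max u w} ℒ) :
      (∀ i, ProdClosure 𝒳 (D i)) → ProdClosure 𝒳 (FA.pi.{u, w} D)

/-- The smallest class that contains `𝒳` and is closed under subprop-categories. -/
inductive SubClosure (𝒳 : Set (FA.{u, w} ℒ)) : FA.{u, w} ℒ → Prop
  | of {D : FA.{u, w} ℒ} : D ∈ 𝒳 → SubClosure 𝒳 D
  | sub {D E : FA.{u, w} ℒ} : D.IsSubpropCategory E → SubClosure 𝒳 E → SubClosure 𝒳 D

/-- `ℙ(𝒳)` -/
def opP (𝒳 : Set (FA.{u, max u w} ℒ)) : Set (FA.{u, max u w} ℒ) := {D | ProdClosure.{u, w} 𝒳 D}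

/-- `𝕊(𝒳)` -/
def opS (𝒳 : Set (FA.{u, w} ℒ)) : Set (FA.{u, w} ℒ) := {D | SubClosure 𝒳 D}

/-- `𝕌_Sg(𝒳)`: the class of all `D` such that each classifying subprop-category `(𝒞_T, P_T)` of `D`,
for `T` a theory of the minimal logic over `Sg`, belongs to `𝒳`. -/
def opU (Sg : Signature.{u}) (𝒳 : Set (FA.{u, max u w} ℒ)) : Set (FA.{u, max u w} ℒ) :=
  {D | ∀ (T : Theory ℒ Sg) (hT : T.IsMinimal),
    (classifying.{u, w} hT).IsSubpropCategory D → classifying.{u, w} hT ∈ 𝒳}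

end

end Fibered

namespace Fibered

open CategoryTheory MonoidalCategory CartesianMonoidalCategory Opposite

/-! ### Reindexing and designated products -/

section

theorem PropCategory.re_id (D : PropCategory.{u, w}) {c : D.Base} (r : D.Fib c) :
    D.re (𝟙 c) r = r :=
  ConcreteCategory.congr_hom (D.P.map_id (op c)) r

theorem PropCategory.re_comp (D : PropCategory.{u, w}) {b c d : D.Base} (f : b ⟶ c) (g : c ⟶ d)
    (r : D.Fib d) : D.re (f ≫ g) r = D.re f (D.re g r) :=
  ConcreteCategory.congr_hom (D.P.map_comp g.op f.op) r

theorem PropCategory.re_mono (D : PropCategory.{u, w}) {b c : D.Base} (f : b ⟶ c) {r s : D.Fib c}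
    (h : r ≤ s) : D.re f r ≤ D.re f s :=
  (D.P.map f.op).hom.monotone h

theorem PropCategory.re_le_re_iff (D : PropCategory.{u, w}) {b c : D.Base} (f : b ⟶ c) [IsIso f]
    {r s : D.Fib c} : D.re f r ≤ D.re f s ↔ r ≤ s := by
  refine ⟨fun h => ?_, D.re_mono f⟩
  have k := D.re_mono (inv f) h
  rwa [← D.re_comp, ← D.re_comp, IsIso.inv_hom_id, D.re_id, D.re_id] at k

variable (D : PropCategory.{u, w}) {S : Type u} (s : S → D.Base)

@[simp] theorem PropCategory.tuple_proj {c : D.Base} : (Γ : List S) →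
    (f : ∀ τ, Var Γ τ → (c ⟶ s τ)) → {τ : S} → (x : Var Γ τ) →
      D.tuple s Γ f ≫ D.proj s Γ x = f τ x
  | [_], _, _, .zero => Category.comp_id _
  | _ :: _ :: _, _, _, .zero => lift_snd _ _
  | _ :: τ :: Γ, f, _, .succ x =>
    ((Category.assoc _ _ _).symm.trans (congrArg (· ≫ _) (lift_fst _ _))).trans
      (PropCategory.tuple_proj (τ :: Γ) (fun σ x => f σ (.succ x)) x)

theorem PropCategory.ctx_hom_ext {c : D.Base} : (Γ : List S) → {f g : c ⟶ D.ctx s Γ} →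
    (∀ τ (x : Var Γ τ), f ≫ D.proj s Γ x = g ≫ D.proj s Γ x) → f = g
  | [], _, _, _ => toUnit_unique _ _
  | [_], _, _, h => (Category.comp_id _).symm.trans ((h _ .zero).trans (Category.comp_id _))
  | _ :: τ :: Γ, _, _, h => hom_ext _ _
      (PropCategory.ctx_hom_ext (τ :: Γ) fun σ x =>
        (Category.assoc _ _ _).trans ((h σ (.succ x)).trans (Category.assoc _ _ _).symm))
      (h _ .zero)

theorem PropCategory.comp_tuple {b c : D.Base} (g : b ⟶ c) (Γ : List S)
    (f : ∀ τ, Var Γ τ → (c ⟶ s τ)) :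
    g ≫ D.tuple s Γ f = D.tuple s Γ fun τ x => g ≫ f τ x :=
  D.ctx_hom_ext s Γ fun τ x => by simp

theorem PropCategory.tuple_eta (Γ : List S) :
    D.tuple s Γ (fun _ x => D.proj s Γ x) = 𝟙 _ :=
  D.ctx_hom_ext s Γ fun τ x => by simp

@[simp] theorem PropCategory.snoc_proj_zero (Γ : List S) (σ : S) :
    D.snoc s Γ σ ≫ D.proj s (σ :: Γ) .zero = snd _ _ :=
  D.tuple_proj s (σ :: Γ) _ .zero

@[simp] theorem PropCategory.snoc_proj_succ (Γ : List S) (σ : S) {τ : S} (x : Var Γ τ) :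
    D.snoc s Γ σ ≫ D.proj s (σ :: Γ) (.succ x) = fst _ _ ≫ D.proj s Γ x :=
  D.tuple_proj s (σ :: Γ) _ (.succ x)

/-- The change-in-product isomorphism `⟦Γ⟧ × ⟦Δ⟧ ⟶ ⟦Γ, Δ⟧`. -/
def PropCategory.join (Γ Δ : List S) : D.ctx s Γ ⊗ D.ctx s Δ ⟶ D.ctx s (Δ ++ Γ) :=
  D.tuple s (Δ ++ Γ) (Var.elim (α := fun τ => (D.ctx s Γ ⊗ D.ctx s Δ ⟶ s τ))
    (fun _ x => fst _ _ ≫ D.proj s Γ x) Δ fun _ x => snd _ _ ≫ D.proj s Δ x)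

@[simp] theorem PropCategory.join_proj_inl (Γ Δ : List S) {τ : S} (x : Var Δ τ) :
    D.join s Γ Δ ≫ D.proj s (Δ ++ Γ) (Var.inl x) = snd _ _ ≫ D.proj s Δ x := by
  rw [join, D.tuple_proj, Var.elim_inl]

@[simp] theorem PropCategory.join_proj_inr (Γ Δ : List S) {τ : S} (x : Var Γ τ) :
    D.join s Γ Δ ≫ D.proj s (Δ ++ Γ) (Var.inr Δ x) = fst _ _ ≫ D.proj s Γ x := by
  rw [join, D.tuple_proj, Var.elim_inr]

/-- The inverse of `join`. -/
def PropCategory.split (Γ Δ : List S) : D.ctx s (Δ ++ Γ) ⟶ D.ctx s Γ ⊗ D.ctx s Δ :=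
  lift (D.tuple s Γ fun _ x => D.proj s (Δ ++ Γ) (Var.inr Δ x))
    (D.tuple s Δ fun _ x => D.proj s (Δ ++ Γ) (Var.inl x))

theorem PropCategory.split_join (Γ Δ : List S) : D.split s Γ Δ ≫ D.join s Γ Δ = 𝟙 _ := by
  refine D.ctx_hom_ext s _ fun τ x => ?_
  obtain ⟨y, rfl⟩ | ⟨y, rfl⟩ := Var.append_cases _ x <;> simp [split]

theorem PropCategory.join_split (Γ Δ : List S) : D.join s Γ Δ ≫ D.split s Γ Δ = 𝟙 _ := by
  refine hom_ext _ _ (D.ctx_hom_ext s _ fun τ x => ?_) (D.ctx_hom_ext s _ fun τ x => ?_) <;>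
    simp [split]

theorem PropCategory.join_nil (Γ : List S) : D.join s Γ [] = fst _ _ :=
  D.ctx_hom_ext s _ fun _ x => D.join_proj_inr s Γ [] x

theorem PropCategory.join_singleton (Γ : List S) (σ : S) : D.join s Γ [σ] = D.snoc s Γ σ := by
  refine D.ctx_hom_ext s (σ :: Γ) fun τ x => ?_
  cases x with
  | zero =>
    have h : D.join s Γ [σ] ≫ D.proj s (σ :: Γ) .zero = snd _ _ ≫ 𝟙 _ :=
      D.join_proj_inl s Γ [σ] .zero
    exact h.trans ((Category.comp_id _).trans (D.snoc_proj_zero s Γ σ).symm)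
  | succ x =>
    have h : D.join s Γ [σ] ≫ D.proj s (σ :: Γ) (.succ x) = fst _ _ ≫ D.proj s Γ x :=
      D.join_proj_inr s Γ [σ] x
    exact h.trans (D.snoc_proj_succ s Γ σ x).symm

theorem PropCategory.join_cons_cons (Γ Δ : List S) (σ τ : S) :
    D.join s Γ (σ :: τ :: Δ) =
      (α_ _ _ _).inv ≫ D.join s Γ (τ :: Δ) ▷ s σ ≫ D.snoc s (τ :: Δ ++ Γ) σ := by
  refine D.ctx_hom_ext s (σ :: (τ :: Δ ++ Γ)) fun ρ x => ?_
  suffices h : D.join s Γ (σ :: τ :: Δ) ≫ D.proj s (σ :: (τ :: Δ ++ Γ)) x =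
      (α_ (D.ctx s Γ) (D.ctx s (τ :: Δ)) (s σ)).inv ≫ D.join s Γ (τ :: Δ) ▷ s σ ≫
        D.snoc s (τ :: Δ ++ Γ) σ ≫ D.proj s (σ :: (τ :: Δ ++ Γ)) x from
    h.trans ((Category.assoc _ _ _).trans (congrArg _ (Category.assoc _ _ _))).symm
  cases x with
  | zero =>
    refine (D.join_proj_inl s Γ (σ :: τ :: Δ) .zero).trans ?_
    rw [D.snoc_proj_zero, whiskerRight_snd, associator_inv_snd]
    rfl
  | succ x =>
    rw [D.snoc_proj_succ, whiskerRight_fst_assoc]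
    obtain ⟨y, rfl⟩ | ⟨y, rfl⟩ := Var.append_cases (τ :: Δ) x
    · rw [D.join_proj_inl, associator_inv_fst_snd_assoc]
      exact D.join_proj_inl s Γ (σ :: τ :: Δ) (.succ y)
    · rw [D.join_proj_inr, associator_inv_fst_fst_assoc]
      exact D.join_proj_inr s Γ (σ :: τ :: Δ) y

end

/-! ### Soundness of the minimal logic -/

section

variable {ℒ : Language.{u}} {Sg : Signature.{u}} {D : FA.{u, w} ℒ} (S : Struc Sg D)

/-- The interpretation of a list of terms. -/
def Struc.sub {Γ Δ : List Sg.Srt} (γ : Sub Sg Γ Δ) : D.ctx S.srt Γ ⟶ D.ctx S.srt Δ :=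
  D.tuple S.srt Δ fun σ x => S.term (γ σ x)

@[simp] theorem Struc.sub_proj {Γ Δ : List Sg.Srt} (γ : Sub Sg Γ Δ) {τ : Sg.Srt} (x : Var Δ τ) :
    S.sub γ ≫ D.proj S.srt Δ x = S.term (γ τ x) :=
  D.tuple_proj _ _ _ _

theorem Struc.term_subst {Γ Δ : List Sg.Srt} (γ : Sub Sg Γ Δ) {τ : Sg.Srt} (M : Term Sg Δ τ) :
    S.term (M.subst γ) = S.sub γ ≫ S.term M := by
  induction M with
  | var x => exact (S.sub_proj γ x).symm
  | app f M ih =>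
    simp only [Term.subst, Struc.term, ih]
    rw [← Category.assoc, D.comp_tuple]

theorem Struc.sub_id (Γ : List Sg.Srt) : S.sub (Sub.id Γ) = 𝟙 _ :=
  D.tuple_eta _ _

theorem Struc.sub_comp {Θ Γ Δ : List Sg.Srt} (γ : Sub Sg Θ Γ) (δ : Sub Sg Γ Δ) :
    S.sub (γ.comp δ) = S.sub γ ≫ S.sub δ :=
  D.ctx_hom_ext _ _ fun τ x => by simp [Sub.comp, S.term_subst]

theorem Struc.snoc_sub_up {Γ Δ : List Sg.Srt} (σ : Sg.Srt) (γ : Sub Sg Γ Δ) :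
    D.snoc S.srt Γ σ ≫ S.sub (γ.up σ) = S.sub γ ▷ S.srt σ ≫ D.snoc S.srt Δ σ := by
  refine D.ctx_hom_ext _ _ fun τ x => ?_
  rw [Category.assoc, Category.assoc, S.sub_proj]
  cases x with
  | zero =>
    rw [D.snoc_proj_zero, whiskerRight_snd]
    exact D.snoc_proj_zero _ _ _
  | succ x =>
    rw [D.snoc_proj_succ, whiskerRight_fst_assoc, S.sub_proj, Sub.up, S.term_subst,
      ← Category.assoc]
    congr 1
    refine D.ctx_hom_ext _ _ fun τ x => ?_
    rw [Category.assoc, S.sub_proj]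
    exact D.snoc_proj_succ _ _ _ x

theorem Struc.form_subst {Δ : List Sg.Srt} (φ : Formula ℒ Sg Δ) {Γ : List Sg.Srt}
    (γ : Sub Sg Γ Δ) : S.form (φ.subst γ) = D.re (S.sub γ) (S.form φ) := by
  induction φ generalizing Γ with
  | rel R M =>
    simp only [Formula.subst, Struc.form, S.term_subst]
    rw [← D.re_comp, D.comp_tuple]
  | eq M N =>
    simp only [Formula.subst, Struc.form, S.term_subst]
    rw [← D.re_comp, comp_lift]
  | conn o φ ih =>
    simp only [Formula.subst, Struc.form, ih]
    rw [D.re_conn]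
  | quant Ω σ φ ih =>
    simp only [Formula.subst, Struc.form, ih]
    rw [← D.quant_nat, ← D.re_comp, ← D.re_comp, S.snoc_sub_up]

theorem Struc.form_tens {Γ : List Sg.Srt} (φ ψ : Formula ℒ Sg Γ) :
    S.form (φ.tens ψ) = D.conn ℒ.tensor _ ![S.form φ, S.form ψ] :=
  D.conn₂ _ rfl rfl

theorem Struc.form_unit (Γ : List Sg.Srt) : S.form (.unit Γ) = D.conn ℒ.e _ ![] :=
  D.conn₀ _ _

theorem FA.re_tens (D : FA.{u, w} ℒ) {b c : D.Base} (f : b ⟶ c) (r s : D.Fib c) :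
    D.re f (D.conn ℒ.tensor c ![r, s]) = D.conn ℒ.tensor b ![D.re f r, D.re f s] :=
  (D.re_conn _ _ _).trans (D.conn₂ _ rfl rfl)

theorem FA.re_unit (D : FA.{u, w} ℒ) {b c : D.Base} (f : b ⟶ c) :
    D.re f (D.conn ℒ.e c ![]) = D.conn ℒ.e b ![] :=
  (D.re_conn _ _ _).trans (D.conn₀ _ _)

theorem FA.re_bigTens (D : FA.{u, w} ℒ) {b c : D.Base} (f : b ⟶ c) (l : List (D.Fib c)) :
    D.re f (D.bigTens l) = D.bigTens (l.map (D.re f)) := by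
  induction l with
  | nil => exact D.re_unit f
  | cons r l ih => exact (D.re_tens f _ _).trans (by rw [ih]; rfl)

theorem FA.bigTens_append (D : FA.{u, w} ℒ) {c : D.Base} (l m : List (D.Fib c)) :
    D.bigTens (l ++ m) = D.conn ℒ.tensor c ![D.bigTens l, D.bigTens m] := by
  induction l with
  | nil => exact (D.unit_tens _).symm
  | cons r l ih =>
    simp only [List.cons_append, FA.bigTens, ih]
    rw [D.tens_assoc]

@[simp] theorem FA.bigTens_singleton (D : FA.{u, w} ℒ) {c : D.Base} (r : D.Fib c) :
    D.bigTens [r] = r :=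
  D.tens_unit r

theorem Struc.bigTens_subst {Γ Δ : List Sg.Srt} (γ : Sub Sg Γ Δ) (Φ : List (Formula ℒ Sg Δ)) :
    D.bigTens ((Φ.map fun φ => φ.subst γ).map S.form) =
      D.re (S.sub γ) (D.bigTens (Φ.map S.form)) := by
  rw [D.re_bigTens, List.map_map, List.map_map]
  congr 2
  exact funext fun φ => S.form_subst φ γ

theorem Struc.seq_singleton {Γ : List Sg.Srt} {φ ψ : Formula ℒ Sg Γ} :
    S.Th.Seq [φ] ψ ↔ S.form φ ≤ S.form ψ := by
  change D.bigTens [S.form φ] ≤ _ ↔ _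
  rw [D.bigTens_singleton]

theorem Struc.sub_congr {Γ Δ : List Sg.Srt} {γ δ : Sub Sg Γ Δ}
    (h : ∀ σ x, S.Th.Eqn (γ σ x) (δ σ x)) : S.sub γ = S.sub δ :=
  congrArg (D.tuple S.srt Δ) (funext fun σ => funext fun x => h σ x)

theorem Struc.isMinimal_Th : S.Th.IsMinimal where
  refl _ := Eq.refl _
  symm h := Eq.symm h
  trans h k := Eq.trans h k
  eqn_sub h k := (S.term_subst _ _).trans
    ((congrArg₂ (· ≫ ·) (S.sub_congr h) k).trans (S.term_subst _ _).symm)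
  ax φ := S.seq_singleton.2 le_rfl
  cut h k := S.seq_singleton.2 ((S.seq_singleton.1 h).trans (S.seq_singleton.1 k))
  cwk σ Φ ψ h := by
    change D.bigTens _ ≤ S.form _
    rw [S.bigTens_subst, S.form_subst]
    exact D.re_mono _ h
  sub {Γ Δ γ δ Φ ψ} k h := by
    change D.bigTens _ ≤ S.form _
    rw [S.bigTens_subst, S.form_subst, S.sub_congr k]
    exact D.re_mono _ h
  quant_con Ω σ φ ψ h k := by
    have := le_antisymm (S.seq_singleton.1 h) (S.seq_singleton.1 k)
    refine S.seq_singleton.2 (le_of_eq ?_)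
    simp only [Struc.form, this]
  conn_cong o φ ψ h k := by
    have := fun i => le_antisymm (S.seq_singleton.1 (h i)) (S.seq_singleton.1 (k i))
    refine S.seq_singleton.2 (le_of_eq ?_)
    simp only [Struc.form, this]
  tens_ref Φ Ψ α β θ := by
    change D.bigTens _ ≤ _ ↔ D.bigTens _ ≤ _
    simp only [List.map_append, List.map_cons, D.bigTens_append, FA.bigTens, S.form_tens,
      D.tens_assoc]
  unit_ref Φ Ψ θ := by
    change D.bigTens _ ≤ _ ↔ D.bigTens _ ≤ _
    simp only [List.map_append, List.map_cons, D.bigTens_append, FA.bigTens, S.form_unit,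
      D.unit_tens]

theorem Struc.form_quants (Ω : ℒ.Quant) {Γ : List Sg.Srt} : (Δ : List Sg.Srt) →
    (φ : Formula ℒ Sg (Δ ++ Γ)) → S.form (Formula.quants Ω Δ φ) =
      D.quant Ω (D.ctx S.srt Γ) (D.ctx S.srt Δ) (D.re (D.join S.srt Γ Δ) (S.form φ))
  | [], φ => by
    rw [D.join_nil]
    exact (D.quant_one Ω _).symm
  | [σ], φ => by
    rw [D.join_singleton]
    rfl
  | σ :: τ :: Δ, φ => by
    refine (Struc.form_quants Ω (τ :: Δ) (.quant Ω σ φ)).trans ?_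
    refine (congrArg _ (D.quant_nat Ω _ _ _).symm).trans ((D.quant_prod Ω _).symm.trans ?_)
    rw [← D.re_comp, ← D.re_comp, D.join_cons_cons, Category.assoc]
    rfl

theorem FA.re_lift_Eq_prod (D : FA.{u, w} ℒ) {b c₁ c₂ : D.Base} (f₁ : b ⟶ c₁) (f₂ : b ⟶ c₂)
    (g₁ : b ⟶ c₁) (g₂ : b ⟶ c₂) :
    D.re (lift (lift f₁ f₂) (lift g₁ g₂)) (D.Eq (c₁ ⊗ c₂)) = D.conn ℒ.tensor b
      ![D.re (lift f₁ g₁) (D.Eq c₁), D.re (lift f₂ g₂) (D.Eq c₂)] := by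
  rw [D.Eq_prod, D.re_tens, ← D.re_comp, ← D.re_comp]
  simp only [comp_lift, lift_fst_assoc, lift_snd_assoc, lift_fst, lift_snd]

theorem Struc.form_eqs {Γ : List Sg.Srt} : (Δ : List Sg.Srt) → (γ δ : Sub Sg Γ Δ) →
    S.form (.eqs Δ γ δ) = D.re (lift (S.sub γ) (S.sub δ)) (D.Eq (D.ctx S.srt Δ))
  | [], γ, δ => by
    refine (S.form_unit Γ).trans ?_
    symm
    exact (congrArg _ D.Eq_one).trans (D.re_unit _)
  | [σ], γ, δ => by
    refine (S.form_tens _ _).trans ?_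
    rw [Formula.eqs, S.form_unit, D.unit_tens]
    rfl
  | σ :: τ :: Δ, γ, δ => by
    refine (S.form_tens _ _).trans ?_
    rw [Struc.form_eqs (τ :: Δ)]
    exact (D.re_lift_Eq_prod (S.sub fun ρ x => γ ρ (.succ x)) (S.term (γ σ .zero))
      (S.sub fun ρ x => δ ρ (.succ x)) (S.term (δ σ .zero))).symm

end

/-! ### The interpretation of the classifying prop-category -/

section

variable {ℒ : Language.{u}} {Sg : Signature.{u}} {T : Theory ℒ Sg} (hT : T.IsMinimal)
  {D : FA.{u, max u w} ℒ} (S : Struc Sg D) (hS : T ⊆ S.Th)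

/-- The functor `Γ ↦ ⟦Γ⟧` on the category of contexts. -/
def Struc.interpFunctor : ClCtx.{u, w} hT ⥤ D.Base where
  obj X := D.ctx S.srt X.ctx
  map f := Quotient.lift (s := hT.subSetoid _ _) S.sub
    (fun _ _ h => S.sub_congr fun σ x => hS (h σ x)) f
  map_id X := S.sub_id X.ctx
  map_comp := by
    rintro X Y Z ⟨γ⟩ ⟨δ⟩
    exact S.sub_comp γ δ

variable {X Y : ClCtx.{u, w} hT}

instance Struc.isIso_prodComparison_interpFunctor :
    IsIso (prodComparison (S.interpFunctor.{u, w} hT hS) X Y) :=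
  ⟨D.join S.srt X.ctx Y.ctx, D.split_join _ _ _, D.join_split _ _ _⟩

theorem Struc.inv_prodComparison_interpFunctor :
    inv (prodComparison (S.interpFunctor.{u, w} hT hS) X Y) = D.join S.srt X.ctx Y.ctx :=
  IsIso.inv_eq_of_hom_inv_id (D.split_join _ _ _)

instance Struc.preservesFiniteProducts_interpFunctor :
    Limits.PreservesFiniteProducts (S.interpFunctor.{u, w} hT hS) :=
  have : IsIso (terminalComparison (S.interpFunctor.{u, w} hT hS)) :=
    ⟨𝟙 _, toUnit_unique _ _, toUnit_unique _ _⟩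
  have := preservesLimitsOfShape_discrete_walkingPair_of_isIso_prodComparison
    (S.interpFunctor.{u, w} hT hS)
  have := preservesLimit_empty_of_isIso_terminalComparison (S.interpFunctor.{u, w} hT hS)
  have := Limits.preservesLimitsOfShape_pempty_of_preservesTerminal (S.interpFunctor.{u, w} hT hS)
  .of_preserves_binary_and_terminal _

/-- The monotone map `⟦-⟧ : P_T(Γ) ⟶ P(⟦Γ⟧)`. -/
def Struc.interpForm (Γ : List Sg.Srt) : ClForm hT Γ →o D.Fib (D.ctx S.srt Γ) where
  toFun := Quotient.lift (s := hT.formSetoid Γ) S.form fun _ _ h =>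
    le_antisymm (S.seq_singleton.1 (hS h.1)) (S.seq_singleton.1 (hS h.2))
  monotone' := by
    rintro ⟨φ⟩ ⟨ψ⟩ h
    exact S.seq_singleton.1 (hS h)

/-- The morphism `(𝒞_T, P_T) ⟶ (𝒞, P)` induced by a model of `T`. -/
noncomputable def Struc.interp : FA.Hom (classifying.{u, w} hT) D where
  o := S.interpFunctor.{u, w} hT hS
  preserves := S.preservesFiniteProducts_interpFunctor hT hS
  p :=
    { app := fun X => PartOrd.ofHom (X := ClForm hT X.unop.ctx) (S.interpForm hT hS X.unop.ctx)
      naturality := by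
        rintro X Y ⟨⟨γ⟩⟩
        ext ⟨φ⟩
        exact S.form_subst φ γ }
  map_conn {n} k c r := by
    choose φ hφ using fun i => ClForm.exists_mk (hT := hT) (r i)
    obtain rfl : (fun i => ClForm.mk hT (φ i)) = r := funext hφ
    exact congrArg (S.interpForm hT hS c.ctx) (ClForm.conn_mk hT k φ)
  map_quant Ω b c r := by
    obtain ⟨φ, rfl⟩ := ClForm.exists_mk (hT := hT) r
    refine (S.form_quants Ω c.ctx φ).trans ?_
    exact congrArg (fun f => D.quant Ω _ _ (D.re f (S.form φ)))
      (S.inv_prodComparison_interpFunctor hT hS).symm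
  map_Eq c := S.form_eqs c.ctx _ _

theorem Struc.interp_isSubprop (h : S.Th ⊆ T) : (S.interp.{u, w} hT hS).IsSubprop := by
  refine ⟨⟨?_⟩, ?_⟩
  · rintro X Y ⟨γ⟩ ⟨δ⟩ (k : S.sub γ = S.sub δ)
    refine Quotient.sound fun σ x => h ?_
    exact (S.sub_proj γ x).symm.trans ((congrArg (· ≫ D.proj _ _ x) k).trans (S.sub_proj δ x))
  · rintro c ⟨φ⟩ ⟨ψ⟩
    exact ⟨fun k => h (S.seq_singleton.2 k), fun k => S.seq_singleton.1 (hS k)⟩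

end

/-! ### The generic structure in the classifying prop-category -/

section

variable {ℒ : Language.{u}} {Sg : Signature.{u}} {T : Theory ℒ Sg} (hT : T.IsMinimal)

/-- The list of terms with the single entry `M`. -/
def Sub.single {Γ : List Sg.Srt} {σ : Sg.Srt} (M : Term Sg Γ σ) : Sub Sg Γ [σ]
  | _, .zero => M

/-- A context as an object of the classifying prop-category. -/
def clObj (Γ : List Sg.Srt) : (classifying.{u, w} hT).Base := (⟨Γ⟩ : ClCtx.{u, w} hT)

/-- A list of terms as a morphism of the classifying prop-category. -/
def clHom {Γ Δ : List Sg.Srt} (γ : Sub Sg Γ Δ) : clObj.{u, w} hT Γ ⟶ clObj.{u, w} hT Δ :=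
  ClCtx.hom hT (X := (⟨Γ⟩ : ClCtx.{u, w} hT)) (Y := ⟨Δ⟩) γ

/-- The class of a formula as an element of the classifying prop-category. -/
def clForm {Γ : List Sg.Srt} (φ : Formula ℒ Sg Γ) :
    (classifying.{u, w} hT).Fib (clObj.{u, w} hT Γ) :=
  ClForm.mk hT φ

/-- The morphism `Γ ⟶ [σ]` given by a term. -/
def clTerm {Γ : List Sg.Srt} {σ : Sg.Srt} (M : Term Sg Γ σ) :
    clObj.{u, w} hT Γ ⟶ clObj.{u, w} hT [σ] :=
  clHom hT (Sub.single M)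

theorem clTerm_eq_iff {Γ : List Sg.Srt} {σ : Sg.Srt} {M N : Term Sg Γ σ} :
    clTerm.{u, w} hT M = clTerm.{u, w} hT N ↔ T.Eqn M N := by
  refine ⟨fun h => Quotient.exact h σ .zero, fun h => Quotient.sound fun τ x => ?_⟩
  match x with
  | .zero => exact h

theorem clHom_comp_clTerm {Γ Δ : List Sg.Srt} (γ : Sub Sg Γ Δ) {σ : Sg.Srt} (M : Term Sg Δ σ) :
    clHom.{u, w} hT γ ≫ clTerm.{u, w} hT M = clTerm.{u, w} hT (M.subst γ) := by
  refine congrArg (Quotient.mk _) (funext fun τ => funext fun x => ?_)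
  match x with
  | .zero => rfl

theorem clHom_surjective {Γ Δ : List Sg.Srt} (f : clObj.{u, w} hT Γ ⟶ clObj.{u, w} hT Δ) :
    ∃ γ, clHom.{u, w} hT γ = f :=
  Quotient.exists_rep f

theorem clTerm_surjective {Γ : List Sg.Srt} {σ : Sg.Srt}
    (f : clObj.{u, w} hT Γ ⟶ clObj.{u, w} hT [σ]) : ∃ M, clTerm.{u, w} hT M = f := by
  obtain ⟨γ, rfl⟩ := clHom_surjective hT f
  refine ⟨γ σ .zero, congrArg (Quotient.mk _) (funext fun τ => funext fun x => ?_)⟩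
  match x with
  | .zero => rfl

theorem clHom_ext {X : (classifying.{u, w} hT).Base} {Δ : List Sg.Srt}
    {f g : X ⟶ clObj.{u, w} hT Δ}
    (h : ∀ τ (x : Var Δ τ), f ≫ clTerm hT (.var x) = g ≫ clTerm hT (.var x)) : f = g := by
  obtain ⟨Γ, rfl⟩ : ∃ Γ, clObj.{u, w} hT Γ = X := ⟨ClCtx.ctx X, rfl⟩
  obtain ⟨γ, rfl⟩ := clHom_surjective hT f
  obtain ⟨δ, rfl⟩ := clHom_surjective hT g
  refine Quotient.sound fun τ x => (clTerm_eq_iff.{u, w} hT).1 ?_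
  have k := h τ x
  rwa [clHom_comp_clTerm, clHom_comp_clTerm] at k

theorem exists_comp_clTerm {X : (classifying.{u, w} hT).Base} {Δ : List Sg.Srt}
    (p : ∀ τ, Var Δ τ → (X ⟶ clObj.{u, w} hT [τ])) :
    ∃ g : X ⟶ clObj.{u, w} hT Δ, ∀ τ (x : Var Δ τ), g ≫ clTerm hT (.var x) = p τ x := by
  obtain ⟨Γ, rfl⟩ : ∃ Γ, clObj.{u, w} hT Γ = X := ⟨ClCtx.ctx X, rfl⟩
  choose γ hγ using fun (τ : Sg.Srt) (x : Var Δ τ) => clTerm_surjective hT (p τ x)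
  exact ⟨clHom hT γ, fun τ x => (clHom_comp_clTerm hT γ _).trans (hγ τ x)⟩

theorem re_lift_clTerm {Γ : List Sg.Srt} {σ : Sg.Srt} (M N : Term Sg Γ σ) :
    (classifying.{u, w} hT).re (lift (clTerm hT M) (clTerm hT N))
      ((classifying.{u, w} hT).Eq (clObj hT [σ])) = clForm hT (.eq M N) :=
  (ClForm.re_Eq hT (Z := (⟨Γ⟩ : ClCtx.{u, w} hT)) (X := ⟨[σ]⟩) _ _).trans (ClForm.unit_tens hT _)

/-- The sorts of the generic structure. -/
abbrev genericSrt (σ : Sg.Srt) : (classifying.{u, w} hT).Base := clObj.{u, w} hT [σ]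

/-- The change-in-product isomorphism `Γ ⟶ ⟦Γ⟧` for the generic structure. -/
noncomputable def genericIso (Γ : List Sg.Srt) :
    clObj.{u, w} hT Γ ⟶ (classifying.{u, w} hT).ctx (genericSrt.{u, w} hT) Γ :=
  (classifying.{u, w} hT).tuple (genericSrt.{u, w} hT) Γ fun _ x => clTerm hT (.var x)

theorem genericIso_proj (Γ : List Sg.Srt) {τ : Sg.Srt} (x : Var Γ τ) :
    genericIso.{u, w} hT Γ ≫ (classifying.{u, w} hT).proj (genericSrt.{u, w} hT) Γ x =
      clTerm hT (.var x) :=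
  PropCategory.tuple_proj _ _ _ _ _

instance isIso_genericIso (Γ : List Sg.Srt) : IsIso (genericIso.{u, w} hT Γ) := by
  obtain ⟨g, hg⟩ := exists_comp_clTerm hT fun τ x =>
    (classifying.{u, w} hT).proj (genericSrt.{u, w} hT) Γ (τ := τ) x
  refine ⟨g, clHom_ext hT fun τ x => ?_, PropCategory.ctx_hom_ext _ _ _ fun τ x => ?_⟩
  · rw [Category.assoc, hg, genericIso_proj, Category.id_comp]
  · rw [Category.assoc, genericIso_proj, hg, Category.id_comp]

/-- The generic structure in the classifying prop-category. -/
noncomputable abbrev generic : Struc Sg (classifying.{u, w} hT) where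
  srt := genericSrt.{u, w} hT
  fn f := inv (genericIso.{u, w} hT (Sg.dom f)) ≫ clTerm hT (.app f fun _ x => .var x)
  rel R := (classifying.{u, w} hT).re (inv (genericIso.{u, w} hT (Sg.ar R)))
    (clForm hT (.rel R fun _ x => .var x))

theorem genericIso_comp_tuple {Γ Δ : List Sg.Srt} (γ : Sub Sg Γ Δ)
    {f : ∀ τ, Var Δ τ → ((classifying.{u, w} hT).ctx (genericSrt.{u, w} hT) Γ ⟶
      genericSrt.{u, w} hT τ)}
    (h : ∀ τ x, genericIso.{u, w} hT Γ ≫ f τ x = clTerm hT (γ τ x)) :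
    genericIso.{u, w} hT Γ ≫ (classifying.{u, w} hT).tuple (genericSrt.{u, w} hT) Δ f =
      clHom hT γ ≫ genericIso.{u, w} hT Δ := by
  refine PropCategory.ctx_hom_ext _ _ _ fun τ x => ?_
  rw [Category.assoc, Category.assoc, PropCategory.tuple_proj, h, genericIso_proj,
    clHom_comp_clTerm]
  rfl

theorem genericIso_term {Γ : List Sg.Srt} {τ : Sg.Srt} (M : Term Sg Γ τ) :
    genericIso.{u, w} hT Γ ≫ (generic.{u, w} hT).term M = clTerm hT M := by
  induction M with
  | var x => exact genericIso_proj hT Γ x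
  | app f M ih =>
    change genericIso hT Γ ≫ PropCategory.tuple _ _ _ _ ≫ inv (genericIso hT (Sg.dom f)) ≫ _ = _
    rw [← Category.assoc, genericIso_comp_tuple hT M ih, Category.assoc, IsIso.hom_inv_id_assoc,
      clHom_comp_clTerm]
    rfl

theorem genericIso_snoc (Γ : List Sg.Srt) (σ : Sg.Srt) :
    genericIso.{u, w} hT Γ ▷ genericSrt.{u, w} hT σ ≫
      (classifying.{u, w} hT).snoc (genericSrt.{u, w} hT) Γ σ = genericIso.{u, w} hT (σ :: Γ) := by
  refine PropCategory.ctx_hom_ext _ _ _ fun τ x => ?_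
  refine (Category.assoc _ _ _).trans (Eq.trans ?_ (genericIso_proj hT _ x).symm)
  cases x with
  | zero =>
    rw [PropCategory.snoc_proj_zero, whiskerRight_snd]
    refine congrArg (Quotient.mk _) (funext fun τ => funext fun x => ?_)
    match x with
    | .zero => rfl
  | succ x =>
    rw [PropCategory.snoc_proj_succ, whiskerRight_fst_assoc, genericIso_proj]
    exact clHom_comp_clTerm hT (Sub.fst Γ [σ]) (.var x)

theorem genericIso_form {Γ : List Sg.Srt} (φ : Formula ℒ Sg Γ) :
    (classifying.{u, w} hT).re (genericIso.{u, w} hT Γ) ((generic.{u, w} hT).form φ) =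
      clForm hT φ := by
  induction φ with
  | @rel Γ R M =>
    change PropCategory.re _ (genericIso hT Γ) (PropCategory.re _ (PropCategory.tuple _ _ _ _)
      (PropCategory.re _ (inv (genericIso hT (Sg.ar R))) _)) = _
    rw [← PropCategory.re_comp, ← PropCategory.re_comp,
      genericIso_comp_tuple hT M fun τ x => genericIso_term hT _, Category.assoc,
      IsIso.hom_inv_id, Category.comp_id]
    rfl
  | @eq Γ σ M N =>
    refine (PropCategory.re_comp _ _ _ _).symm.trans ?_
    rw [comp_lift, genericIso_term, genericIso_term]
    exact re_lift_clTerm hT M N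
  | conn o φ ih =>
    refine (FA.re_conn _ _ _ _).trans (Eq.trans (congrArg _ (funext ih)) ?_)
    exact ClForm.conn_mk hT o φ
  | @quant Γ Ω σ φ ih =>
    refine (FA.quant_nat (classifying.{u, w} hT) Ω (genericIso.{u, w} hT Γ) _ _).symm.trans ?_
    refine congrArg ((classifying.{u, w} hT).quant Ω (clObj hT Γ) (clObj hT [σ])) (a₂ := clForm hT φ)
      ((PropCategory.re_comp _ _ _ _).symm.trans ?_)
    exact (congrArg (fun f => (classifying.{u, w} hT).re f _) (genericIso_snoc hT Γ σ)).trans ih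

/-- The formula `φ₁ ⊗ ⋯ ⊗ φₙ`, which is `e` for `n = 0`. -/
def Formula.bigTens {Γ : List Sg.Srt} : List (Formula ℒ Sg Γ) → Formula ℒ Sg Γ
  | [] => .unit Γ
  | φ :: Φ => φ.tens (Formula.bigTens Φ)

theorem Struc.form_bigTens {D : FA.{u, w} ℒ} (S : Struc Sg D) {Γ : List Sg.Srt}
    (Φ : List (Formula ℒ Sg Γ)) : S.form (.bigTens Φ) = D.bigTens (Φ.map S.form) := by
  induction Φ with
  | nil => exact S.form_unit Γ
  | cons φ Φ ih => exact (S.form_tens _ _).trans (by rw [ih]; rfl)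

theorem Theory.IsMinimal.seq_append_bigTens (hT : T.IsMinimal) {Γ : List Sg.Srt}
    (Ψ Φ : List (Formula ℒ Sg Γ)) (θ : Formula ℒ Sg Γ) : T.Seq (Ψ ++ [.bigTens Φ]) θ ↔ T.Seq (Ψ ++ Φ) θ := by
  induction Φ generalizing Ψ with
  | nil => exact hT.unit_ref Ψ [] θ
  | cons φ Φ ih =>
    refine (hT.tens_ref Ψ [] φ (.bigTens Φ) θ).symm.trans ?_
    have h := ih (Ψ ++ [φ])
    rwa [List.append_assoc, List.append_assoc] at h

theorem generic_Th : (generic.{u, w} hT).Th = T := by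
  ext a
  cases a with
  | eqn Γ τ M N =>
    change (generic.{u, w} hT).term M = (generic.{u, w} hT).term N ↔ T.Eqn M N
    refine Iff.trans ?_ (clTerm_eq_iff.{u, w} hT)
    refine (cancel_epi (genericIso.{u, w} hT Γ)).symm.trans ?_
    exact iff_of_eq (congrArg₂ _ (genericIso_term hT M) (genericIso_term hT N))
  | seq Γ Φ ψ =>
    change FA.bigTens _ (Φ.map (generic.{u, w} hT).form) ≤ (generic.{u, w} hT).form ψ ↔ T.Seq Φ ψ
    rw [← Struc.form_bigTens]
    refine Iff.trans ?_ (hT.seq_append_bigTens [] Φ ψ)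
    refine (PropCategory.re_le_re_iff _ (genericIso.{u, w} hT Γ)).symm.trans ?_
    exact iff_of_eq (congrArg₂ _ (genericIso_form hT _) (genericIso_form hT _))

end

/-! ### Transport of structures along morphisms -/

section

variable {ℒ : Language.{u}} {Sg : Signature.{u}} {D E : FA.{u, w} ℒ} (F : FA.Hom D E)

instance FA.Hom.preservesFiniteProducts : Limits.PreservesFiniteProducts F.o := F.preserves

/-- The monotone map `Fᵖ_c`. -/
abbrev FA.Hom.fib (c : D.Base) (r : D.Fib c) : E.Fib (F.o.obj c) := F.p.app (op c) r

theorem FA.Hom.fib_re {b c : D.Base} (f : b ⟶ c) (r : D.Fib c) :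
    F.fib b (D.re f r) = E.re (F.o.map f) (F.fib c r) :=
  ConcreteCategory.congr_hom (F.p.naturality f.op) r

/-- The change-in-product isomorphism `Fᵒ⟦Γ⟧ ⟶ ⟦Γ⟧`. -/
def FA.Hom.ctxComparison {S : Type u} (s : S → D.Base) (Γ : List S) :
    F.o.obj (D.ctx s Γ) ⟶ E.ctx (fun σ => F.o.obj (s σ)) Γ :=
  E.tuple _ Γ fun _ x => F.o.map (D.proj s Γ x)

@[simp] theorem FA.Hom.ctxComparison_proj {S : Type u} (s : S → D.Base) (Γ : List S) {τ : S}
    (x : Var Γ τ) : F.ctxComparison s Γ ≫ E.proj (fun σ => F.o.obj (s σ)) Γ x =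
      F.o.map (D.proj s Γ x) :=
  E.tuple_proj _ _ _ _

instance FA.Hom.isIso_ctxComparison {S : Type u} (s : S → D.Base) :
    (Γ : List S) → IsIso (F.ctxComparison s Γ)
  | [] => inferInstanceAs (IsIso (terminalComparison F.o))
  | [σ] => inferInstanceAs (IsIso (F.o.map (𝟙 (s σ))))
  | σ :: τ :: Γ => by
    have := FA.Hom.isIso_ctxComparison s (τ :: Γ)
    have h : F.ctxComparison s (σ :: τ :: Γ) = prodComparison F.o (D.ctx s (τ :: Γ)) (s σ) ≫
        F.ctxComparison s (τ :: Γ) ▷ F.o.obj (s σ) := by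
      refine hom_ext _ _ ((lift_fst _ _).trans ?_) ((lift_snd _ _).trans ?_)
      · refine Eq.trans ?_ (((Category.assoc _ _ _).trans (congrArg _ (whiskerRight_fst _ _))).trans
          (prodComparison_fst_assoc _ _ _ _)).symm
        refine E.ctx_hom_ext _ (τ :: Γ) fun ρ x => ?_
        refine (E.tuple_proj _ (τ :: Γ) _ x).trans (Eq.trans ?_ (Category.assoc _ _ _).symm)
        exact (F.o.map_comp _ _).trans (congrArg _ (F.ctxComparison_proj s (τ :: Γ) x).symm)
      · exact (((Category.assoc _ _ _).trans (congrArg _ (whiskerRight_snd _ _))).trans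
          (prodComparison_snd _ _ _)).symm
    exact h ▸ (inferInstance : IsIso (prodComparison F.o (D.ctx s (τ :: Γ)) (s σ) ≫
        F.ctxComparison s (τ :: Γ) ▷ F.o.obj (s σ)))

theorem FA.Hom.map_tuple_ctxComparison {S : Type u} (s : S → D.Base) {c : D.Base} (Γ : List S)
    (f : ∀ τ, Var Γ τ → (c ⟶ s τ)) : F.o.map (D.tuple s Γ f) ≫ F.ctxComparison s Γ =
      E.tuple (fun σ => F.o.obj (s σ)) Γ fun _ x => F.o.map (f _ x) := by
  refine E.ctx_hom_ext _ _ fun τ x => ?_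
  rw [Category.assoc, F.ctxComparison_proj, E.tuple_proj, ← F.o.map_comp, D.tuple_proj]

theorem FA.Hom.ctxComparison_snoc {S : Type u} (s : S → D.Base) (Γ : List S) (σ : S) :
    F.ctxComparison s Γ ▷ F.o.obj (s σ) ≫ E.snoc (fun σ => F.o.obj (s σ)) Γ σ =
      inv (prodComparison F.o (D.ctx s Γ) (s σ)) ≫ F.o.map (D.snoc s Γ σ) ≫
        F.ctxComparison s (σ :: Γ) := by
  rw [IsIso.eq_inv_comp]
  refine E.ctx_hom_ext _ _ fun τ x => ?_
  simp only [Category.assoc]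
  rw [F.ctxComparison_proj, ← F.o.map_comp]
  cases x with
  | zero => rw [E.snoc_proj_zero, D.snoc_proj_zero, whiskerRight_snd, prodComparison_snd]
  | succ x =>
    rw [E.snoc_proj_succ, D.snoc_proj_succ, whiskerRight_fst_assoc, prodComparison_fst_assoc,
      F.ctxComparison_proj, F.o.map_comp]

/-- The image of a structure under a morphism of prop-categories. -/
noncomputable abbrev Struc.map (S : Struc Sg D) : Struc Sg E where
  srt σ := F.o.obj (S.srt σ)
  fn f := inv (F.ctxComparison S.srt (Sg.dom f)) ≫ F.o.map (S.fn f)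
  rel R := E.re (inv (F.ctxComparison S.srt (Sg.ar R))) (F.fib _ (S.rel R))

variable (S : Struc Sg D)

theorem Struc.ctxComparison_tuple {Γ Δ : List Sg.Srt}
    {f : ∀ τ, Var Δ τ → (D.ctx S.srt Γ ⟶ S.srt τ)}
    {g : ∀ τ, Var Δ τ → (E.ctx (S.map F).srt Γ ⟶ (S.map F).srt τ)}
    (h : ∀ τ x, F.ctxComparison S.srt Γ ≫ g τ x = F.o.map (f τ x)) :
    F.ctxComparison S.srt Γ ≫ E.tuple (S.map F).srt Δ g =
      F.o.map (D.tuple S.srt Δ f) ≫ F.ctxComparison S.srt Δ := by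
  rw [E.comp_tuple, F.map_tuple_ctxComparison]
  exact congrArg _ (funext fun τ => funext fun x => h τ x)

theorem Struc.map_term {Γ : List Sg.Srt} {τ : Sg.Srt} (M : Term Sg Γ τ) :
    F.ctxComparison S.srt Γ ≫ (S.map F).term M = F.o.map (S.term M) := by
  induction M with
  | var x => exact F.ctxComparison_proj _ _ _
  | app f M ih =>
    simp only [Struc.term]
    rw [← Category.assoc, S.ctxComparison_tuple F ih, Category.assoc, IsIso.hom_inv_id_assoc,
      F.o.map_comp]

theorem Struc.map_form {Γ : List Sg.Srt} (φ : Formula ℒ Sg Γ) :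
    E.re (F.ctxComparison S.srt Γ) ((S.map F).form φ) = F.fib _ (S.form φ) := by
  induction φ with
  | rel R M =>
    simp only [Struc.form]
    rw [← E.re_comp, ← E.re_comp, S.ctxComparison_tuple F fun τ x => S.map_term F _,
      Category.assoc, IsIso.hom_inv_id, Category.comp_id, F.fib_re]
  | eq M N =>
    simp only [Struc.form]
    rw [← E.re_comp, comp_lift, S.map_term, S.map_term, F.fib_re]
    refine Eq.trans ?_ (congrArg _ (F.map_Eq _)).symm
    rw [← E.re_comp]
    refine congrArg (fun f => E.re f _) (hom_ext _ _ ?_ ?_)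
    · rw [lift_fst, Category.assoc, prodComparison_fst, ← F.o.map_comp, lift_fst]
    · rw [lift_snd, Category.assoc, prodComparison_snd, ← F.o.map_comp, lift_snd]
  | conn o φ ih =>
    simp only [Struc.form]
    rw [E.re_conn, funext ih]
    exact (F.map_conn _ _ _).symm
  | @quant Γ Ω σ φ ih =>
    refine Eq.trans ?_ (F.map_quant Ω _ _ _).symm
    refine (E.quant_nat Ω _ _ _).symm.trans (congrArg _ ?_)
    refine Eq.trans ?_ (congrArg _ (F.fib_re (D.snoc S.srt Γ σ) (S.form φ))).symm
    rw [← ih, ← E.re_comp, ← E.re_comp, ← E.re_comp, F.ctxComparison_snoc,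
      Category.assoc]

theorem Struc.map_sat_eqn {Γ : List Sg.Srt} {τ : Sg.Srt} (M N : Term Sg Γ τ) :
    (S.map F).Sat (.eqn Γ τ M N) ↔ F.o.map (S.term M) = F.o.map (S.term N) := by
  rw [← S.map_term F, ← S.map_term F, cancel_epi]
  rfl

theorem Struc.map_sat_seq {Γ : List Sg.Srt} (Φ : List (Formula ℒ Sg Γ)) (ψ : Formula ℒ Sg Γ) :
    (S.map F).Sat (.seq Γ Φ ψ) ↔
      F.fib _ (D.bigTens (Φ.map S.form)) ≤ F.fib _ (S.form ψ) := by
  rw [← S.form_bigTens, ← S.map_form F, ← S.map_form F, E.re_le_re_iff, Struc.form_bigTens]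
  rfl

theorem Struc.Th_map (hF : F.IsSubprop) : (S.map F).Th = S.Th := by
  ext a
  cases a with
  | eqn Γ τ M N =>
    have := hF.1
    exact (S.map_sat_eqn F M N).trans F.o.map_injective.eq_iff
  | seq Γ Φ ψ => exact (S.map_sat_seq F Φ ψ).trans (hF.2 _ _ _)

end

/-! ### Structures in products -/

section

variable {ℒ : Language.{u}} {Sg : Signature.{u}} {I : Type u} (D : I → FA.{u, max u w} ℒ) (i : I)

/-- The projection functor of a product of prop-categories. -/
def FA.piEvalFunctor : (FA.pi.{u, w} D).Base ⥤ (D i).Base where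
  obj c := c i
  map f := f i

theorem FA.prodComparison_piEvalFunctor (b c : (FA.pi.{u, w} D).Base) :
    prodComparison (FA.piEvalFunctor D i) b c = 𝟙 (b i ⊗ c i) :=
  lift_fst_snd

instance FA.isIso_prodComparison_piEvalFunctor (b c : (FA.pi.{u, w} D).Base) :
    IsIso (prodComparison (FA.piEvalFunctor D i) b c) :=
  FA.prodComparison_piEvalFunctor D i b c ▸ (inferInstance : IsIso (𝟙 (b i ⊗ c i)))

theorem FA.inv_prodComparison_piEvalFunctor (b c : (FA.pi.{u, w} D).Base) :
    inv (prodComparison (FA.piEvalFunctor D i) b c) = 𝟙 (b i ⊗ c i) :=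
  IsIso.inv_eq_of_hom_inv_id
    ((Category.comp_id _).trans (FA.prodComparison_piEvalFunctor D i b c))

instance FA.preservesFiniteProducts_piEvalFunctor :
    Limits.PreservesFiniteProducts (FA.piEvalFunctor.{u, w} D i) :=
  have : IsIso (terminalComparison (FA.piEvalFunctor.{u, w} D i)) :=
    ⟨𝟙 _, toUnit_unique _ _, toUnit_unique _ _⟩
  have := preservesLimitsOfShape_discrete_walkingPair_of_isIso_prodComparison
    (FA.piEvalFunctor.{u, w} D i)
  have := preservesLimit_empty_of_isIso_terminalComparison (FA.piEvalFunctor.{u, w} D i)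
  have := Limits.preservesLimitsOfShape_pempty_of_preservesTerminal (FA.piEvalFunctor.{u, w} D i)
  .of_preserves_binary_and_terminal _

/-- The projection morphism of a product of prop-categories. -/
noncomputable def FA.piEval : FA.Hom (FA.pi.{u, w} D) (D i) where
  o := FA.piEvalFunctor D i
  preserves := FA.preservesFiniteProducts_piEvalFunctor D i
  p :=
    { app := fun c => PartOrd.ofHom (X := ∀ i, (D i).Fib (c.unop i)) (Y := (D i).Fib (c.unop i))
        ⟨fun r => r i, fun _ _ h => h i⟩
      naturality := fun _ _ _ => rfl }
  map_conn _ _ _ := rfl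
  map_quant Ω b c r := by
    rw [FA.inv_prodComparison_piEvalFunctor]
    exact congrArg ((D i).quant Ω (b i) (c i)) ((D i).re_id _).symm
  map_Eq c := by
    rw [FA.prodComparison_piEvalFunctor]
    exact ((D i).re_id _).symm

theorem Struc.sat_iff_forall_piEval (S : Struc Sg (FA.pi.{u, w} D)) (a : Assertion ℒ Sg) :
    S.Sat a ↔ ∀ i, (S.map (FA.piEval D i)).Sat a := by
  cases a with
  | eqn Γ τ M N =>
    refine Iff.trans ?_ (forall_congr' fun i => (S.map_sat_eqn (FA.piEval D i) M N).symm)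
    exact funext_iff
  | seq Γ Φ ψ => exact forall_congr' fun i => (S.map_sat_seq (FA.piEval D i) Φ ψ).symm

theorem Struc.exists_pi (S : ∀ i, Struc Sg (D i)) :
    ∃ S' : Struc Sg (FA.pi.{u, w} D), ∀ i, S'.map (FA.piEval D i) = S i := by
  let s : Sg.Srt → (FA.pi.{u, w} D).Base := fun σ i => (S i).srt σ
  refine ⟨⟨s, fun f i => (FA.piEval D i).ctxComparison s (Sg.dom f) ≫ (S i).fn f,
    fun R i => (D i).re ((FA.piEval D i).ctxComparison s (Sg.ar R)) ((S i).rel R)⟩, fun i => ?_⟩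
  have h₁ (f : Sg.Fn) : inv ((FA.piEval D i).ctxComparison s (Sg.dom f)) ≫
      (FA.piEval D i).ctxComparison s (Sg.dom f) ≫ (S i).fn f = (S i).fn f :=
    IsIso.inv_hom_id_assoc _ _
  have h₂ (R : Sg.Rel) : (D i).re (inv ((FA.piEval D i).ctxComparison s (Sg.ar R)))
      ((D i).re ((FA.piEval D i).ctxComparison s (Sg.ar R)) ((S i).rel R)) = (S i).rel R :=
    ((D i).re_comp _ _ _).symm.trans
      ((congrArg (fun f => (D i).re f _) (IsIso.inv_hom_id _)).trans ((D i).re_id _))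
  exact congrArg₂ (Struc.mk (S i).srt) (funext h₁) (funext h₂)

end

/-! ### Soundness and completeness -/

section

variable {ℒ : Language.{u}} {Sg : Signature.{u}}

theorem mem_soundClass_semLogic {𝒳 : Set (FA.{u, w} ℒ)} {D : FA.{u, w} ℒ} :
    D ∈ soundClass (semLogic Sg 𝒳) ↔
      ∀ (S : Struc Sg D) (a : Assertion ℒ Sg), Entails 𝒳 S.Th {a} → S.Sat a := by
  refine ⟨fun h S a ha => ?_, fun h T T' hT' E hE S hS a ha => ?_⟩
  · exact h S.Th {a} (Set.singleton_subset_iff.2 ha) D rfl S le_rfl rfl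
  · obtain rfl : E = D := hE
    exact h S a fun E hE S' hS' => hT' ha E hE S' (hS.trans hS')

theorem soundClass_of_isSubprop {𝒳 : Set (FA.{u, w} ℒ)} {D E : FA.{u, w} ℒ}
    (h : D.IsSubpropCategory E) (hE : E ∈ soundClass (semLogic Sg 𝒳)) :
    D ∈ soundClass (semLogic Sg 𝒳) := by
  obtain ⟨ι, hι⟩ := h
  rw [mem_soundClass_semLogic] at hE ⊢
  intro S a ha
  rw [← S.Th_map ι hι] at ha
  exact (S.Th_map ι hι).subset (hE _ a ha)

theorem subset_soundClass (𝒳 : Set (FA.{u, w} ℒ)) : 𝒳 ⊆ soundClass (semLogic Sg 𝒳) :=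
  fun D hD => mem_soundClass_semLogic.2 fun S _ ha => ha D hD S le_rfl rfl

theorem opS_subset_soundClass {𝒳 𝒴 : Set (FA.{u, w} ℒ)}
    (h : 𝒴 ⊆ soundClass (semLogic Sg 𝒳)) : opS 𝒴 ⊆ soundClass (semLogic Sg 𝒳) := by
  intro D hD
  induction hD with
  | of hD => exact h hD
  | sub hDE _ ih => exact soundClass_of_isSubprop hDE ih

theorem opP_subset_soundClass (𝒳 : Set (FA.{u, max u w} ℒ)) :
    opP.{u, w} 𝒳 ⊆ soundClass (semLogic Sg 𝒳) := by
  intro D hD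
  induction hD with
  | of hD => exact subset_soundClass 𝒳 hD
  | pi D _ ih =>
    refine mem_soundClass_semLogic.2 fun S a ha => ?_
    refine (S.sat_iff_forall_piEval D a).2 fun i => ?_
    refine mem_soundClass_semLogic.1 (ih i) _ a fun E hE S' hS' => ha E hE S' fun b hb => hS' ?_
    exact (S.sat_iff_forall_piEval D b).1 hb i

/-- A theory that is closed under `⊨_𝒳` is the theory of a structure in a product of members
of `𝒳`. -/
theorem exists_struc_Th_eq (𝒳 : Set (FA.{u, max u w} ℒ)) (T : Theory ℒ Sg)
    (hT : ∀ a, Entails 𝒳 T {a} → a ∈ T) : ∃ D ∈ opP.{u, w} 𝒳, ∃ S : Struc Sg D, S.Th = T := by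
  have h : ∀ a : {a // a ∉ T}, ∃ D ∈ 𝒳, ∃ S : Struc Sg D, T ⊆ S.Th ∧ ¬ S.Sat a := by
    intro a
    by_contra! h
    exact a.2 (hT a fun D hD S hS => Set.singleton_subset_iff.2 (h D hD S hS))
  choose D hD S hS ha using h
  obtain ⟨S', hS'⟩ := Struc.exists_pi.{u, w} D S
  refine ⟨_, .pi D fun a => .of (hD a), S', Set.ext fun b => ?_⟩
  refine (S'.sat_iff_forall_piEval D b).trans ⟨fun hb => ?_, fun hb a => ?_⟩
  · by_contra hbT
    exact ha ⟨b, hbT⟩ (hS' ⟨b, hbT⟩ ▸ hb ⟨b, hbT⟩)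
  · rw [hS']
    exact hS a hb

end

end Fibered

theorem mainTheorem3 (ℒ : Fibered.Language.{u}) (Sg : Fibered.Signature.{u})
    (𝒳 : Set (Fibered.FA.{u, max u w} ℒ)) :
    Fibered.soundClass (Fibered.semLogic Sg 𝒳) =
      Fibered.opU.{u, w} Sg (Fibered.opS (Fibered.opP.{u, w} 𝒳)) := by
  refine Set.Subset.antisymm (fun D hD T hT hTD => ?_) fun D hD => ?_
  · have hC := Fibered.mem_soundClass_semLogic.1 (Fibered.soundClass_of_isSubprop hTD hD)
    obtain ⟨E, hE, S, rfl⟩ := Fibered.exists_struc_Th_eq.{u, w} 𝒳 T fun a ha =>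
      (Fibered.generic_Th.{u, w} hT).subset (hC (Fibered.generic.{u, w} hT) a (by
        rwa [Fibered.generic_Th]))
    exact .sub ⟨S.interp hT le_rfl, S.interp_isSubprop hT le_rfl le_rfl⟩ (.of hE)
  · refine Fibered.mem_soundClass_semLogic.2 fun S a ha => ?_
    have hC := Fibered.opS_subset_soundClass (Fibered.opP_subset_soundClass.{u, w} (Sg := Sg) 𝒳)
      (hD S.Th S.isMinimal_Th ⟨S.interp S.isMinimal_Th le_rfl,
        S.interp_isSubprop S.isMinimal_Th le_rfl le_rfl⟩)
    have k := Fibered.mem_soundClass_semLogic.1 hC (Fibered.generic.{u, w} S.isMinimal_Th) a (by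
      rwa [Fibered.generic_Th])
    exact (Fibered.generic_Th.{u, w} S.isMinimal_Th).subset k
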